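/- Let $M$ be a (finite-dimensional, Hausdorff, second countable) smooth manifold, $L\to M$ a real line bundle, $A=C^\infty(M)$, $P=\Gamma(L)$, and let $\mathscr A=A\oplus P$ be the graded commutative algebra with $A$ in degree $0$, $P$ in degree $1$ and $P\cdot P=0$. Let $J^1L$ be the first jet bundle of $L$ and $j_1:\Gamma(L)\to\Gamma(J^1L)$ the jet prolongation. A *Jacobi bracket of degree $-1$* on $\mathscr A$ is an $\mathbb R$-bilinear bracket $\{-,-\}:\mathscr A\times\mathscr A\to\mathscr A$ with $\{\mathscr A_i,\mathscr A_j\}\subseteq\mathscr A_{i+j-1}$ such that 1. it is a graded Lie bracket of degree $-1$: for homogeneous $x,y$ of degrees $i,j$ and all $z$, $\{x,y\}=-(-1)^{(i-1)(j-1)}\{y,x\}$ and $\{x,\{y,z\}\}=\{\{x,y\},z\}+(-1)^{(i-1)(j-1)}\{y,\{x,z\}\}$; 2. it is a differential operator of order $\le 1$ over $A$ in each entry, i.e. $\delta_b\delta_a\{x,-\}=0$ for all $x\in\mathscr A$, $a,b\in A$, where $\delta_a\Delta=a\circ\Delta-\Delta\circ a$; 3. for every $p\in P$ the operator $\{p,-\}$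 is a derivation of $\mathscr A$; that is, $\{p,-\}|_A$ is a derivation of $A$ and is the symbol of $\{p,-\}|_P$. A *Jacobi algebroid structure* on $(J^1L,L)$ is a triple $([-,-],\rho,\nabla)$, where $([-,-],\rho)$ is a Lie algebroid structure on $J^1L$ and $\nabla$ is a representation of it on $L$, i.e. an $\mathbb R$-bilinear map $\Gamma(J^1L)\times\Gamma(L)\to\Gamma(L)$ with $\nabla_{f\alpha}e=f\nabla_\alpha e$, $\nabla_\alpha(fe)=\rho(\alpha)(f)e+f\nabla_\alpha e$ and $\nabla_{[\alpha,\beta]}=[\nabla_\alpha,\nabla_\beta]$. Then there is a bijection between the Jacobi brackets of degree $-1$ on $C^\infty(M)\oplus\Gamma(L)$ and the Jacobi algebroid structures on $(J^1L,L)$ that satisfy $$[j_1p_1,j_1p_2]=j_1\big(\nabla_{j_1p_1}p_2\big)\qquad(p_1,p_2\in\Gamma(L)).$$ To a bracket $\{-,-\}$ it assigns the unique such structure with $\nabla_{j_1p_1}p_2=\{p_1,p_2\}$ for all $p_1,p_2\in\Gamma(L)$, and this structure satisfies $\rho(j_1p)(a)=\{p,a\}$ for all $p\in\Gamma(L)$,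 $a\in C^\infty(M)$. -/

import Mathlib

open scoped Manifold ContDiff Topology

noncomputable section

/-! ## Algebraic notions: differential operators, diole algebras, Jacobi algebroids -/

section Algebraic

/-- The commutator `δ_a φ = a ∘ φ - φ ∘ a` of a map between `A`-modules with multiplication
by `a`. -/
def diffCommutator {A P Q : Type*} [SMul A P] [AddCommGroup Q] [SMul A Q]
    (a : A) (φ : P → Q) : P → Q :=
  fun p => a • φ p - φ (a • p)

/-- `φ` is a linear differential operator of order `≤ 1` over `A`: `δ_b (δ_a φ) = 0`
for all `a b : A`. -/
def IsFirstOrderDiffOp (A : Type*) {P Q : Type*} [CommRing A] [AddCommGroup P] [Module A P]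
    [AddCommGroup Q] [Module A Q] [Module ℝ P] [Module ℝ Q] (φ : P →ₗ[ℝ] Q) : Prop :=
  ∀ a b : A, ∀ p : P, diffCommutator b (diffCommutator a φ) p = 0

/-- The diole algebra `𝒜 = A ⊕ P`: the commutative algebra in which `A` acts on `P` and
`P · P = 0`. -/
abbrev Diole (A P : Type*) : Type _ := TrivSqZeroExt A P

/-- `x ∈ A ⊕ P` is homogeneous of degree `i`, where `A` is the component of degree `0`, `P` is
the component of degree `1`, and all other components vanish. -/
def Diole.IsHomogeneous {A P : Type*} [Zero A] [Zero P] (i : ℤ) (x : Diole A P) : Prop :=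
  (i ≠ 0 → x.fst = 0) ∧ (i ≠ 1 → x.snd = 0)

/-- A Jacobi bracket of degree `-1` on the diole algebra `𝒜 = A ⊕ P`: a graded Lie bracket of
degree `-1` which is a first order bidifferential operator, and for which every `{p, -}`,
`p ∈ P`, is a derivation of `𝒜`, that is, acts on `P` as a first order operator whose
symbol is its action on `A`. By skew-symmetry the conditions hold in both entries. -/
@[ext]
structure DegNegOneJacobiBracket (A P : Type*) [CommRing A] [Algebra ℝ A] [AddCommGroup P]
    [Module ℝ P] [Module A P] [Module Aᵐᵒᵖ P] [IsCentralScalar A P] where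
  bracket : Diole A P →ₗ[ℝ] Diole A P →ₗ[ℝ] Diole A P
  degree : ∀ (i j : ℤ) (x y : Diole A P), x.IsHomogeneous i → y.IsHomogeneous j →
    (bracket x y).IsHomogeneous (i + j - 1)
  skew : ∀ (i j : ℤ) (x y : Diole A P), x.IsHomogeneous i → y.IsHomogeneous j →
    bracket x y = -(((i - 1) * (j - 1)).negOnePow • bracket y x)
  jacobi : ∀ (i j : ℤ) (x y z : Diole A P), x.IsHomogeneous i → y.IsHomogeneous j →
    bracket x (bracket y z) =
      bracket (bracket x y) z + ((i - 1) * (j - 1)).negOnePow • bracket y (bracket x z)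
  firstOrder : ∀ x : Diole A P, IsFirstOrderDiffOp A (bracket x)
  derivation : ∀ x y z : Diole A P, x.IsHomogeneous 1 →
    bracket x (y * z) = bracket x y * z + y * bracket x z

/-- A Lie algebroid structure on a vector bundle over `M`, in terms of the algebra `A = C^∞(M)`,
whose derivations are the vector fields on `M`, and of the module `S` of sections. -/
@[ext]
structure LieAlgebroidStructure (A S : Type*) [CommRing A] [Algebra ℝ A] [AddCommGroup S]
    [Module ℝ S] [Module A S] where
  bracket : S →ₗ[ℝ] S →ₗ[ℝ] S
  bracket_self : ∀ α : S, bracket α α = 0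
  jacobi : ∀ α β γ : S,
    bracket α (bracket β γ) = bracket (bracket α β) γ + bracket β (bracket α γ)
  anchor : S →ₗ[A] Derivation ℝ A A
  anchor_bracket : ∀ α β : S, anchor (bracket α β) = ⁅anchor α, anchor β⁆
  leibniz : ∀ (α β : S) (f : A), bracket α (f • β) = f • bracket α β + anchor α f • β

/-- A Jacobi algebroid structure `([-,-], ρ, ∇)`: a Lie algebroid structure on the bundle with
module of sections `S`, and a representation `∇` of it on the line bundle with module of
sections `P`. -/
@[ext]
structure JacobiAlgebroidStructure (A S P : Type*) [CommRing A] [Algebra ℝ A] [AddCommGroup S]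
    [Module ℝ S] [Module A S] [AddCommGroup P] [Module ℝ P] [Module A P]
    extends LieAlgebroidStructure A S where
  nabla : S →ₗ[ℝ] P →ₗ[ℝ] P
  nabla_smul : ∀ (f : A) (α : S) (e : P), nabla (f • α) e = f • nabla α e
  nabla_leibniz : ∀ (α : S) (f : A) (e : P),
    nabla α (f • e) = anchor α f • e + f • nabla α e
  nabla_bracket : ∀ (α β : S) (e : P),
    nabla (bracket α β) e = nabla α (nabla β e) - nabla β (nabla α e)

end Algebraic

/-! ## Smooth functions, sections of a line bundle, and its first jet bundle -/

section Geometric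

/-- The algebra `C^∞(M)`. -/
abbrev SmoothFun (E M : Type*) [NormedAddCommGroup E] [NormedSpace ℝ E]
    [TopologicalSpace M] [ChartedSpace E M] : Type _ :=
  C^∞⟮𝓘(ℝ, E), M; ℝ⟯

/-- The smooth sections `Γ(L)` of a real line bundle `L` over `M`. -/
abbrev LineSec (E : Type*) {M : Type*} [NormedAddCommGroup E] [NormedSpace ℝ E]
    [TopologicalSpace M] [ChartedSpace E M] (L : M → Type*)
    [TopologicalSpace (Bundle.TotalSpace ℝ L)] [∀ x, AddCommGroup (L x)] [∀ x, Module ℝ (L x)]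
    [∀ x, TopologicalSpace (L x)] [FiberBundle ℝ L] [VectorBundle ℝ ℝ L] : Type _ :=
  Cₛ^∞⟮𝓘(ℝ, E); ℝ, L⟯

variable {E M : Type*} [NormedAddCommGroup E] [NormedSpace ℝ E]
    [TopologicalSpace M] [ChartedSpace E M] {L : M → Type*}
    [TopologicalSpace (Bundle.TotalSpace ℝ L)] [∀ x, AddCommGroup (L x)] [∀ x, Module ℝ (L x)]
    [∀ x, TopologicalSpace (L x)] [FiberBundle ℝ L] [VectorBundle ℝ ℝ L]

instance LineSec.instSMulSmoothFun : SMul (SmoothFun E M) (LineSec E L) where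
  smul f s := ⟨fun x => f x • s x, f.contMDiff.smul_section s.contMDiff⟩

@[simp]
theorem LineSec.smul_apply (f : SmoothFun E M) (s : LineSec E L) (x : M) :
    (f • s) x = f x • s x := rfl

/-- `Γ(L)` is a `C^∞(M)`-module under pointwise multiplication. -/
instance LineSec.instModuleSmoothFun : Module (SmoothFun E M) (LineSec E L) where
  one_smul s := by ext x; simp
  mul_smul f g s := by ext x; simp [mul_smul]
  smul_zero f := by ext x; simp
  smul_add f s t := by ext x; simp
  add_smul f g s := by ext x; simp [add_smul]
  zero_smul s := by ext x; simp

/-- The same action written on the right, as the multiplication of `C^∞(M) ⊕ Γ(L)` uses it. -/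
instance LineSec.instModuleSmoothFunOp : Module (SmoothFun E M)ᵐᵒᵖ (LineSec E L) :=
  Module.compHom (LineSec E L)
    ((RingHom.id (SmoothFun E M)).fromOpposite fun f g => mul_comm f g)

instance LineSec.instIsCentralScalar : IsCentralScalar (SmoothFun E M) (LineSec E L) where
  op_smul_eq_smul _ _ := rfl

/-- The ideal `μ_x` of smooth functions vanishing at `x`. -/
def vanishingIdeal (E : Type*) {M : Type*} [NormedAddCommGroup E] [NormedSpace ℝ E]
    [TopologicalSpace M] [ChartedSpace E M] (x : M) : Ideal (SmoothFun E M) :=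
  RingHom.ker (ContMDiffMap.evalRingHom x : SmoothFun E M →+* ℝ)

/-- The sections of `L` that vanish at `x` together with their first derivatives:
the submodule `μ_x² Γ(L)`, regarded as a real vector space. -/
def vanishingToFirstOrder (E : Type*) {M : Type*} [NormedAddCommGroup E] [NormedSpace ℝ E]
    [TopologicalSpace M] [ChartedSpace E M] (L : M → Type*)
    [TopologicalSpace (Bundle.TotalSpace ℝ L)] [∀ x, AddCommGroup (L x)] [∀ x, Module ℝ (L x)]
    [∀ x, TopologicalSpace (L x)] [FiberBundle ℝ L] [VectorBundle ℝ ℝ L] (x : M) :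
    Submodule ℝ (LineSec E L) :=
  Submodule.span ℝ
    ((vanishingIdeal E x ^ 2 • (⊤ : Submodule (SmoothFun E M) (LineSec E L)) :
      Submodule (SmoothFun E M) (LineSec E L)) : Set (LineSec E L))

/-- The fibre `J¹_x L = Γ(L) / μ_x² Γ(L)` of the first jet bundle, as a real vector space. -/
def JetFiber (E : Type*) {M : Type*} [NormedAddCommGroup E] [NormedSpace ℝ E]
    [TopologicalSpace M] [ChartedSpace E M] (L : M → Type*)
    [TopologicalSpace (Bundle.TotalSpace ℝ L)] [∀ x, AddCommGroup (L x)] [∀ x, Module ℝ (L x)]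
    [∀ x, TopologicalSpace (L x)] [FiberBundle ℝ L] [VectorBundle ℝ ℝ L] (x : M) : Type _ :=
  LineSec E L ⧸ vanishingToFirstOrder E L x

instance JetFiber.instAddCommGroup (x : M) : AddCommGroup (JetFiber E L x) :=
  inferInstanceAs (AddCommGroup (LineSec E L ⧸ vanishingToFirstOrder E L x))

instance JetFiber.instModule (x : M) : Module ℝ (JetFiber E L x) :=
  inferInstanceAs (Module ℝ (LineSec E L ⧸ vanishingToFirstOrder E L x))

/-- The first jet `j¹_x s` at `x` of a section `s`. -/
def jetAt (x : M) : LineSec E L →ₗ[ℝ] JetFiber E L x :=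
  (vanishingToFirstOrder E L x).mkQ

/-- A family `σ x ∈ J¹_x L` is smooth if near every point it is a finite combination
`∑ f_i • j¹ s_i` with smooth coefficients `f_i`, the combination being encoded by a finitely
supported function `s ↦ f` on sections. -/
def IsSmoothJetFamily (σ : ∀ x : M, JetFiber E L x) : Prop :=
  ∀ x₀ : M, ∃ c : LineSec E L →₀ SmoothFun E M,
    ∀ᶠ x in 𝓝 x₀, σ x = c.sum fun s f => f x • jetAt x s

theorem IsSmoothJetFamily.add {σ τ : ∀ x : M, JetFiber E L x} (hσ : IsSmoothJetFamily σ)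
    (hτ : IsSmoothJetFamily τ) : IsSmoothJetFamily (σ + τ) := by
  intro x₀
  obtain ⟨c, hc⟩ := hσ x₀
  obtain ⟨d, hd⟩ := hτ x₀
  refine ⟨c + d, ?_⟩
  filter_upwards [hc, hd] with x h₁ h₂
  classical
  rw [Pi.add_apply, h₁, h₂, Finsupp.sum_add_index']
  · intro s; simp
  · intro s f g; simp [add_smul]

theorem IsSmoothJetFamily.zero : IsSmoothJetFamily (0 : ∀ x : M, JetFiber E L x) :=
  fun _ => ⟨0, by simp⟩

theorem IsSmoothJetFamily.smul (f : SmoothFun E M) {σ : ∀ x : M, JetFiber E L x}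
    (hσ : IsSmoothJetFamily σ) : IsSmoothJetFamily fun x => f x • σ x := by
  intro x₀
  obtain ⟨c, hc⟩ := hσ x₀
  refine ⟨c.mapRange (fun g => f * g) (mul_zero f), ?_⟩
  filter_upwards [hc] with x h
  rw [h, Finsupp.sum_mapRange_index (by simp), Finsupp.smul_sum]
  simp [mul_smul]

theorem IsSmoothJetFamily.const_smul (r : ℝ) {σ : ∀ x : M, JetFiber E L x}
    (hσ : IsSmoothJetFamily σ) : IsSmoothJetFamily (r • σ) :=
  IsSmoothJetFamily.smul (algebraMap ℝ (SmoothFun E M) r) hσ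

theorem IsSmoothJetFamily.jet (s : LineSec E L) :
    IsSmoothJetFamily fun x : M => jetAt (E := E) x s :=
  fun _ => ⟨Finsupp.single s 1, by simp⟩

/-- The real vector space `Γ(J¹L)` of smooth sections of the first jet bundle. -/
def jetSecSubmodule (E : Type*) {M : Type*} [NormedAddCommGroup E] [NormedSpace ℝ E]
    [TopologicalSpace M] [ChartedSpace E M] (L : M → Type*)
    [TopologicalSpace (Bundle.TotalSpace ℝ L)] [∀ x, AddCommGroup (L x)] [∀ x, Module ℝ (L x)]
    [∀ x, TopologicalSpace (L x)] [FiberBundle ℝ L] [VectorBundle ℝ ℝ L] :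
    Submodule ℝ (∀ x : M, JetFiber E L x) where
  carrier := {σ | IsSmoothJetFamily σ}
  add_mem' := IsSmoothJetFamily.add
  zero_mem' := IsSmoothJetFamily.zero
  smul_mem' r _ hσ := hσ.const_smul r

/-- The smooth sections `Γ(J¹L)` of the first jet bundle `J¹L`. -/
abbrev JetSec (E : Type*) {M : Type*} [NormedAddCommGroup E] [NormedSpace ℝ E]
    [TopologicalSpace M] [ChartedSpace E M] (L : M → Type*)
    [TopologicalSpace (Bundle.TotalSpace ℝ L)] [∀ x, AddCommGroup (L x)] [∀ x, Module ℝ (L x)]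
    [∀ x, TopologicalSpace (L x)] [FiberBundle ℝ L] [VectorBundle ℝ ℝ L] : Type _ :=
  jetSecSubmodule E L

instance JetSec.instSMulSmoothFun : SMul (SmoothFun E M) (JetSec E L) where
  smul f σ := ⟨fun x => f x • σ.1 x, IsSmoothJetFamily.smul f σ.2⟩

theorem JetSec.smul_apply (f : SmoothFun E M) (σ : JetSec E L) (x : M) :
    (f • σ).1 x = f x • σ.1 x := rfl

/-- `Γ(J¹L)` is a `C^∞(M)`-module under pointwise multiplication. -/
instance JetSec.instModuleSmoothFun : Module (SmoothFun E M) (JetSec E L) where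
  one_smul σ := Subtype.ext <| funext fun x => by simp [JetSec.smul_apply]
  mul_smul f g σ := Subtype.ext <| funext fun x => by simp [JetSec.smul_apply, mul_smul]
  smul_zero f := Subtype.ext <| funext fun x => by simp [JetSec.smul_apply]
  smul_add f σ τ := Subtype.ext <| funext fun x => by simp [JetSec.smul_apply]
  add_smul f g σ := Subtype.ext <| funext fun x => by simp [JetSec.smul_apply, add_smul]
  zero_smul σ := Subtype.ext <| funext fun x => by simp [JetSec.smul_apply]

/-- The first jet prolongation `j₁ : Γ(L) → Γ(J¹L)`, `(j₁ s)(x) = j¹_x s`. -/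
def jetProlongation : LineSec E L →ₗ[ℝ] JetSec E L where
  toFun s := ⟨fun x => jetAt x s, IsSmoothJetFamily.jet s⟩
  map_add' s t := Subtype.ext <| funext fun x => (jetAt x).map_add s t
  map_smul' r s := Subtype.ext <| funext fun x => (jetAt x).map_smul r s

end Geometric

end

noncomputable section

/-! ## The algebra of jet modules -/

section JetModule

set_option linter.unusedSectionVars false

variable {A P Q S : Type*} [CommRing A] [Algebra ℝ A]
  [AddCommGroup P] [Module ℝ P] [Module A P] [AddCommGroup Q] [Module ℝ Q] [Module A Q]
  [AddCommGroup S] [Module ℝ S] [Module A S]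

/-! Write `A` for the functions, `P` for the sections of `L`, `S` for the sections of the jet bundle
and `j : P → S` for the prolongation. For degree reasons `{A, A} = 0`, and `{a, p} = -{p, a}`. So a
bracket of degree `-1` amounts to a Lie bracket on `P` and a Lie algebra map `p ↦ X_p` into the
derivations of `A`, of first order in `p`, with `{p, a q} = X_p(a) q + a {p, q}`. This is a
`JacobiPair`.

First order operators on `P` are the same as `A`-linear maps on `S`. Hence `X` and `{-, q}` extend
uniquely along `j` to an anchor `ρ` and a representation `∇`. In the same way `{-, -}` extends to a
skew `A`-bilinear map `B : S × S → P`, and the derivation `∇_σ` of `P` lifts to a Lie derivative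
`D_σ` of `S`. The algebroid bracket is `[σ, τ] = D_σ τ - D_τ σ - j B(σ, τ)`, the analogue of the
Koszul bracket of 1-forms on a Poisson manifold. The defect of each algebroid identity is `A`-linear
in every argument from `S`, so it need only vanish on prolongations, where it is an identity of the
pair (`exists_jacobiAlgebroidStructure`). Conversely, `∇` and `ρ` restricted to prolongations form a
pair, and the Leibniz rules make the structure unique.

The geometry enters through `IsJetProlongation` alone. Its hardest field is the Lie derivative:
sections of the jet bundle are only locally, and not uniquely, combinations `∑ f_i j s_i`.
Independence of the presentation holds because first order operators separate jets
(`jetAt_eq_zero`), which rests on Hadamard's lemma. -/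

theorem isFirstOrderDiffOp_iff {φ : P →ₗ[ℝ] Q} :
    IsFirstOrderDiffOp A φ ↔
      ∀ (a b : A) (p : P), φ (a • b • p) = a • φ (b • p) + b • φ (a • p) - (a * b) • φ p := by
  simp only [IsFirstOrderDiffOp, diffCommutator]
  refine forall_congr' fun a => forall_congr' fun b => forall_congr' fun p => ?_
  rw [← sub_eq_zero (a := φ (a • b • p))]
  constructor <;> intro h <;> rw [← h] <;> module

/-- `A`-linear maps `S → Q` are determined by their values on `j P`. -/
def DeterminedOn (A : Type*) {P S : Type*} (Q : Type*) [CommRing A] [AddCommGroup S] [Module A S]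
    [AddCommGroup Q] [Module A Q] (j : P → S) : Prop :=
  ∀ T : S → Q, (∀ σ τ, T (σ + τ) = T σ + T τ) → (∀ (f : A) σ, T (f • σ) = f • T σ) →
    (∀ p, T (j p) = 0) → ∀ σ, T σ = 0

/-- Only the difference has to be `A`-linear, so this also compares two maps that obey the same
Leibniz rule. -/
theorem DeterminedOn.eq {j : P → S} (h : DeterminedOn A Q j) (T T' : S → Q)
    (hadd : ∀ σ τ, T (σ + τ) = T σ + T τ) (hadd' : ∀ σ τ, T' (σ + τ) = T' σ + T' τ)
    (hsmul : ∀ (f : A) σ, T (f • σ) - T' (f • σ) = f • (T σ - T' σ))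
    (hj : ∀ p, T (j p) = T' (j p)) (σ : S) : T σ = T' σ :=
  sub_eq_zero.1 <| h (fun σ => T σ - T' σ) (fun σ τ => by simp only [hadd, hadd']; abel)
    hsmul (fun p => sub_eq_zero.2 (hj p)) σ

/-- `Δ` is a derivation of the module `P` with symbol `X`. -/
def IsDerivationOver (X : Derivation ℝ A A) (Δ : P →ₗ[ℝ] P) : Prop :=
  ∀ (f : A) (p : P), Δ (f • p) = X f • p + f • Δ p

theorem IsDerivationOver.isFirstOrderDiffOp {X : Derivation ℝ A A} {Δ : P →ₗ[ℝ] P}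
    (h : IsDerivationOver X Δ) : IsFirstOrderDiffOp A Δ := by
  rw [isFirstOrderDiffOp_iff]
  intro a b p
  simp only [h _ _]
  module

/-- The properties of `j = j₁ : Γ(L) → Γ(J¹L)` that the algebra of Jacobi algebroids uses. -/
structure IsJetProlongation (A : Type*) {P S : Type*} [CommRing A] [Algebra ℝ A]
    [AddCommGroup P] [Module ℝ P] [Module A P] [AddCommGroup S] [Module ℝ S] [Module A S]
    (j : P →ₗ[ℝ] S) : Prop where
  injective : Function.Injective j
  firstOrder : IsFirstOrderDiffOp A j
  faithful : ∀ a : A, (∀ p : P, a • p = 0) → a = 0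
  determined_fun : DeterminedOn A A j
  determined_sec : DeterminedOn A P j
  determined_jet : DeterminedOn A S j
  lift_fun : ∀ D : P →ₗ[ℝ] A, IsFirstOrderDiffOp A D → ∃ T : S →ₗ[A] A, ∀ p, T (j p) = D p
  lift_sec : ∀ D : P →ₗ[ℝ] P, IsFirstOrderDiffOp A D → ∃ T : S →ₗ[A] P, ∀ p, T (j p) = D p
  lieDerivative : ∀ (X : Derivation ℝ A A) (Δ : P →ₗ[ℝ] P), IsDerivationOver X Δ →
    ∃ T : S →ₗ[ℝ] S, (∀ p, T (j p) = j (Δ p)) ∧ IsDerivationOver X T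

/-- A Lie algebra structure on `P` acting by derivations of `A ⊕ P`, with first order symbol. -/
structure JacobiPair (A P : Type*) [CommRing A] [Algebra ℝ A] [AddCommGroup P]
    [Module ℝ P] [Module A P] where
  lie : P →ₗ[ℝ] P →ₗ[ℝ] P
  symbol : P →ₗ[ℝ] Derivation ℝ A A
  skew : ∀ p q, lie p q = -lie q p
  jacobi : ∀ p q r, lie p (lie q r) = lie (lie p q) r + lie q (lie p r)
  leibniz : ∀ p, IsDerivationOver (symbol p) (lie p)
  symbol_lie : ∀ p q, symbol (lie p q) = ⁅symbol p, symbol q⁆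
  symbol_firstOrder : ∀ (c a b : A) (p : P), symbol (a • b • p) c =
    a • symbol (b • p) c + b • symbol (a • p) c - (a * b) • symbol p c

namespace IsJetProlongation

variable {j : P →ₗ[ℝ] S} (hj : IsJetProlongation A j) (K : JacobiPair A P)
include hj

theorem jet_smul_smul (a b : A) (p : P) :
    j (a • b • p) = a • j (b • p) + b • j (a • p) - (a * b) • j p :=
  isFirstOrderDiffOp_iff.1 hj.firstOrder a b p

variable [IsScalarTower ℝ A S]

/-- For fixed `a` the operator `p ↦ X_p(a)` is of first order and factors through `j`. Additivity
and the product rule in `a` are equalities of `A`-linear maps on `S`, so they can be checked on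
prolongations. -/
theorem exists_anchor :
    ∃ ρ : S →ₗ[A] Derivation ℝ A A, ∀ p, ρ (j p) = K.symbol p := by
  have hD (a : A) : ∃ T : S →ₗ[A] A, ∀ p, T (j p) = K.symbol p a :=
    hj.lift_fun
      { toFun := fun p => K.symbol p a
        map_add' := fun p q => by simp
        map_smul' := fun r p => by simp }
      (isFirstOrderDiffOp_iff.2 fun b c p => K.symbol_firstOrder a b c p)
  choose T hT using hD
  have hext (F : S → A) (F' : S →ₗ[A] A) (h₁ : ∀ σ τ, F (σ + τ) = F σ + F τ)
      (h₂ : ∀ (f : A) σ, F (f • σ) = f • F σ) (h₃ : ∀ p, F (j p) = F' (j p)) (σ : S) :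
      F σ = F' σ :=
    hj.determined_fun.eq F F' h₁ (map_add F') (fun f σ => by rw [h₂, map_smul, smul_sub]) h₃ σ
  have hadd (a b : A) (σ : S) : T (a + b) σ = T a σ + T b σ :=
    (hext (fun σ => T a σ + T b σ) (T (a + b)) (fun σ τ => by simp only [map_add]; abel)
      (fun f σ => by simp only [map_smul, smul_add]) (fun p => by simp [hT]) σ).symm
  have hsmul (r : ℝ) (a : A) (σ : S) : T (r • a) σ = r • T a σ :=
    (hext (fun σ => r • T a σ) (T (r • a)) (fun σ τ => by simp only [map_add, smul_add])
      (fun f σ => by simp only [map_smul]; rw [smul_comm]) (fun p => by simp [hT]) σ).symm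
  have hmul (a b : A) (σ : S) : T (a * b) σ = a • T b σ + b • T a σ :=
    (hext (fun σ => a • T b σ + b • T a σ) (T (a * b))
      (fun σ τ => by simp only [map_add, smul_add]; abel)
      (fun f σ => by simp only [map_smul, smul_eq_mul]; ring) (fun p => by simp [hT]) σ).symm
  exact ⟨{ toFun := fun σ => Derivation.mk'
              { toFun := fun a => T a σ
                map_add' := fun a b => hadd a b σ
                map_smul' := fun r a => hsmul r a σ } (fun a b => hmul a b σ)
           map_add' := fun σ τ => by ext a; simp
           map_smul' := fun f σ => by ext a; simp },
    fun p => by ext a; exact hT a p⟩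

theorem exists_nabla [IsScalarTower ℝ A P] (ρ : S →ₗ[A] Derivation ℝ A A)
    (hρ : ∀ p, ρ (j p) = K.symbol p) :
    ∃ N : S →ₗ[ℝ] P →ₗ[ℝ] P, (∀ p, N (j p) = K.lie p) ∧
      (∀ (f : A) (σ : S) (e : P), N (f • σ) e = f • N σ e) ∧
      ∀ σ, IsDerivationOver (ρ σ) (N σ) := by
  have hD (q : P) : ∃ T : S →ₗ[A] P, ∀ p, T (j p) = K.lie p q := by
    obtain ⟨T, hT⟩ := hj.lift_sec (K.lie q) (K.leibniz q).isFirstOrderDiffOp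
    exact ⟨-T, fun p => by simp [hT, K.skew p q]⟩
  choose T hT using hD
  have hext (F : S → P) (F' : S →ₗ[A] P) (h₁ : ∀ σ τ, F (σ + τ) = F σ + F τ)
      (h₂ : ∀ (f : A) σ, F (f • σ) = f • F σ) (h₃ : ∀ p, F (j p) = F' (j p)) (σ : S) :
      F σ = F' σ :=
    hj.determined_sec.eq F F' h₁ (map_add F') (fun f σ => by rw [h₂, map_smul, smul_sub]) h₃ σ
  have hadd (a b : P) (σ : S) : T (a + b) σ = T a σ + T b σ :=
    (hext (fun σ => T a σ + T b σ) (T (a + b)) (fun σ τ => by simp only [map_add]; abel)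
      (fun f σ => by simp only [map_smul, smul_add]) (fun p => by simp [hT]) σ).symm
  have hsmul (r : ℝ) (a : P) (σ : S) : T (r • a) σ = r • T a σ :=
    (hext (fun σ => r • T a σ) (T (r • a)) (fun σ τ => by simp only [map_add, smul_add])
      (fun f σ => by
        simp only [map_smul]
        rw [← algebraMap_smul A r, ← algebraMap_smul A r, smul_smul, smul_smul, mul_comm])
      (fun p => by simp [hT]) σ).symm
  have hmul (a : A) (e : P) (σ : S) : T (a • e) σ = ρ σ a • e + a • T e σ :=
    (hext (fun σ => ρ σ a • e + a • T e σ) (T (a • e))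
      (fun σ τ => by simp only [map_add, smul_add, Derivation.add_apply, add_smul]; abel)
      (fun f σ => by
        simp only [map_smul, Derivation.smul_apply, smul_eq_mul]; module)
      (fun p => by simp [hT, hρ, K.leibniz p a e]) σ).symm
  exact ⟨LinearMap.mk₂ ℝ (fun σ e => T e σ) (fun σ τ e => map_add _ _ _)
      (fun r σ e => by rw [← algebraMap_smul A r σ, map_smul, algebraMap_smul])
      (fun σ e e' => hadd e e' σ) (fun r σ e => hsmul r e σ),
    fun p => by ext q; simp [hT], fun f σ e => by simp, fun σ f e => by simp [hmul]⟩

/-- `B` is the `A`-bilinear map behind the bidifferential operator `{-, -}`: when `N` comes from the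
pair, `B (j p) (j q)` is `{p, q}`. -/
theorem exists_pairing [IsScalarTower ℝ A P] (ρ : S →ₗ[A] Derivation ℝ A A)
    (N : S →ₗ[ℝ] P →ₗ[ℝ] P)
    (hN : ∀ (f : A) (σ : S) (e : P), N (f • σ) e = f • N σ e)
    (hNρ : ∀ σ, IsDerivationOver (ρ σ) (N σ)) :
    ∃ B : S →ₗ[A] S →ₗ[A] P, ∀ σ p, B σ (j p) = N σ p := by
  choose T hT using fun σ => hj.lift_sec (N σ) (hNρ σ).isFirstOrderDiffOp
  have hext (F : S → P) (F' : S →ₗ[A] P) (h₁ : ∀ σ τ, F (σ + τ) = F σ + F τ)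
      (h₂ : ∀ (f : A) σ, F (f • σ) = f • F σ) (h₃ : ∀ p, F (j p) = F' (j p)) (σ : S) :
      F σ = F' σ :=
    hj.determined_sec.eq F F' h₁ (map_add F') (fun f σ => by rw [h₂, map_smul, smul_sub]) h₃ σ
  refine ⟨LinearMap.mk₂ A (fun σ τ => T σ τ) (fun σ σ' τ => ?_) (fun f σ τ => ?_)
    (fun σ τ τ' => map_add _ _ _) (fun f σ τ => map_smul _ _ _), fun σ p => hT σ p⟩
  · exact (hext (fun τ => T σ τ + T σ' τ) (T (σ + σ')) (fun σ τ => by simp only [map_add]; abel)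
      (fun f σ => by simp only [map_smul, smul_add]) (fun p => by simp [hT]) τ).symm
  · exact (hext (fun τ => f • T σ τ) (T (f • σ)) (fun σ τ => by simp only [map_add, smul_add])
      (fun g σ => by simp only [map_smul, smul_comm f]) (fun p => by simp [hT, hN]) τ).symm

/-- `D` fails to be `A`-linear in `σ` because `D_{fσ} (j p) = j (f ∇_σ p)` and `j` is only of first
order. The defect is expressed by `B`. -/
theorem exists_lieDerivative [IsScalarTower ℝ A P] (ρ : S →ₗ[A] Derivation ℝ A A)
    (N : S →ₗ[ℝ] P →ₗ[ℝ] P)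
    (hN : ∀ (f : A) (σ : S) (e : P), N (f • σ) e = f • N σ e)
    (hNρ : ∀ σ, IsDerivationOver (ρ σ) (N σ))
    (B : S →ₗ[A] S →ₗ[A] P) (hB : ∀ σ p, B σ (j p) = N σ p) :
    ∃ D : S →ₗ[ℝ] S →ₗ[ℝ] S, (∀ σ p, D σ (j p) = j (N σ p)) ∧
      (∀ σ, IsDerivationOver (ρ σ) (D σ)) ∧
      ∀ (f : A) (σ τ : S), D (f • σ) τ = f • D σ τ + j (f • B σ τ) - f • j (B σ τ) := by
  choose T hT hT' using fun σ => hj.lieDerivative (ρ σ) (N σ) (hNρ σ)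
  refine ⟨LinearMap.mk₂ ℝ (fun σ τ => T σ τ) (fun σ σ' τ => ?_) (fun r σ τ => ?_)
    (fun σ τ τ' => map_add _ _ _) (fun f σ τ => map_smul _ _ _), fun σ p => hT σ p,
    fun σ => hT' σ, fun f σ τ => ?_⟩
  · refine hj.determined_jet.eq (fun τ => T (σ + σ') τ) (fun τ => T σ τ + T σ' τ) (map_add _)
      (fun σ τ => by simp only [map_add]; abel) (fun f τ => ?_) (fun p => by simp [hT]) τ
    simp only [hT' _ _ _, map_add, Derivation.add_apply]
    module
  · refine hj.determined_jet.eq (fun τ => T (r • σ) τ) (fun τ => r • T σ τ) (map_add _)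
      (fun σ τ => by simp only [map_add, smul_add]) (fun f τ => ?_) (fun p => by simp [hT]) τ
    simp only [hT' _ _ _, ← algebraMap_smul A r, map_smul, Derivation.smul_apply]
    module
  · refine hj.determined_jet.eq (fun τ => T (f • σ) τ)
      (fun τ => f • T σ τ + j (f • B σ τ) - f • j (B σ τ)) (map_add _)
      (fun σ τ => by simp only [map_add, smul_add]; abel) (fun g τ => ?_)
      (fun p => by simp [hT, hB, hN]) τ
    simp only [hT' _ _ _, map_smul, Derivation.smul_apply, hj.jet_smul_smul f g, smul_eq_mul]
    module

theorem exists_jacobiAlgebroidStructure [IsScalarTower ℝ A P] :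
    ∃ J : JacobiAlgebroidStructure A S P, (∀ p, J.nabla (j p) = K.lie p) ∧
      (∀ p, J.anchor (j p) = K.symbol p) ∧
      ∀ p q, J.bracket (j p) (j q) = j (K.lie p q) := by
  obtain ⟨ρ, hρ⟩ := hj.exists_anchor K
  obtain ⟨N, hNj, hN, hNρ⟩ := hj.exists_nabla K ρ hρ
  obtain ⟨B, hB⟩ := hj.exists_pairing ρ N hN hNρ
  obtain ⟨D, hDj, hD, hDl⟩ := hj.exists_lieDerivative ρ N hN hNρ B hB
  have hBskew (σ τ : S) : B σ τ = -B τ σ := by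
    refine hj.determined_sec.eq (fun τ => B σ τ) (fun τ => -B τ σ) (map_add _)
      (fun τ τ' => by simp only [map_add, LinearMap.add_apply]; abel)
      (fun f τ => by simp only [map_smul, LinearMap.smul_apply]; module) (fun p => ?_) τ
    refine hj.determined_sec.eq (fun σ => B σ (j p)) (fun σ => -B (j p) σ)
      (fun τ τ' => by simp only [map_add, LinearMap.add_apply])
      (fun τ τ' => by simp only [map_add]; abel)
      (fun f τ => by simp only [map_smul, LinearMap.smul_apply]; module) (fun q => ?_) σ
    simp only [hB, hNj]
    exact K.skew q p
  have hBself (σ : S) : B σ σ = 0 := by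
    have h := hBskew σ σ
    have h2 : (2 : ℝ) • B σ σ = 0 := by rw [two_smul]; nth_rw 1 [h]; abel
    exact (smul_eq_zero.1 h2).resolve_left two_ne_zero
  -- On prolongations the three terms are `j{p, q}`, `-j{q, p}` and `-j{p, q}`, with sum `j{p, q}`.
  let br : S →ₗ[ℝ] S →ₗ[ℝ] S := LinearMap.mk₂ ℝ (fun σ τ => D σ τ - D τ σ - j (B σ τ))
    (fun σ σ' τ => by simp only [map_add, LinearMap.add_apply]; abel)
    (fun r σ τ => by
      have : B (r • σ) τ = r • B σ τ := by
        rw [← algebraMap_smul A r σ, map_smul, LinearMap.smul_apply, algebraMap_smul]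
      simp only [map_smul, LinearMap.smul_apply, this, smul_sub])
    (fun σ τ τ' => by simp only [map_add, LinearMap.add_apply]; abel)
    (fun r σ τ => by
      have : B σ (r • τ) = r • B σ τ := by
        rw [← algebraMap_smul A r τ, map_smul, algebraMap_smul]
      simp only [map_smul, LinearMap.smul_apply, this, smul_sub])
  have hbr (σ τ : S) : br σ τ = D σ τ - D τ σ - j (B σ τ) := rfl
  have hskew (σ τ : S) : br σ τ = -br τ σ := by
    rw [hbr, hbr, hBskew σ τ, map_neg]; abel
  have hbrj (p q : P) : br (j p) (j q) = j (K.lie p q) := by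
    rw [hbr, hDj, hDj, hB, hNj, hNj, K.skew q p, map_neg]; abel
  -- By skew-symmetry of `B`, the term `j (f B(σ, τ))` from the defect of `D_{fτ} σ` cancels the one
  -- in `-j B(σ, fτ)`.
  have hleib (σ τ : S) (f : A) : br σ (f • τ) = f • br σ τ + ρ σ f • τ := by
    rw [hbr, hbr, hD σ f τ, hDl, hBskew τ σ, (B σ).map_smul f τ, smul_neg, map_neg, map_neg]
    module
  have hleib' (σ τ : S) (f : A) : br (f • σ) τ = f • br σ τ - ρ τ f • σ := by
    rw [hskew, hleib, hskew σ τ]; module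
  -- By `hleib` and `hleib'` both sides have the same non-linear terms under multiplication by `f`,
  -- so the difference is tensorial in `τ`, then in `σ`. The same holds for `hNbr`.
  have hρbr (σ τ : S) : ρ (br σ τ) = ⁅ρ σ, ρ τ⁆ := by
    ext c
    rw [Derivation.commutator_apply]
    refine hj.determined_fun.eq (fun τ => ρ (br σ τ) c) (fun τ => ρ σ (ρ τ c) - ρ τ (ρ σ c))
      (fun τ τ' => by simp only [map_add, Derivation.add_apply])
      (fun τ τ' => by simp only [map_add, Derivation.add_apply]; abel) (fun f τ => ?_)
      (fun q => ?_) τ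
    · simp only [hleib, map_add, map_smul, Derivation.add_apply, Derivation.smul_apply,
        smul_eq_mul, Derivation.leibniz]
      ring
    refine hj.determined_fun.eq (fun σ => ρ (br σ (j q)) c)
      (fun σ => ρ σ (ρ (j q) c) - ρ (j q) (ρ σ c))
      (fun τ τ' => by simp only [map_add, LinearMap.add_apply, Derivation.add_apply])
      (fun τ τ' => by simp only [map_add, Derivation.add_apply]; abel) (fun f τ => ?_)
      (fun p => ?_) σ
    · simp only [hleib', map_sub, map_smul, Derivation.sub_apply, Derivation.smul_apply,
        smul_eq_mul, Derivation.leibniz]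
      ring
    simp only [hbrj, hρ, K.symbol_lie, Derivation.commutator_apply]
  have hNbr (σ τ : S) (e : P) : N (br σ τ) e = N σ (N τ e) - N τ (N σ e) := by
    refine hj.determined_sec.eq (fun τ => N (br σ τ) e) (fun τ => N σ (N τ e) - N τ (N σ e))
      (fun τ τ' => by simp only [map_add, LinearMap.add_apply])
      (fun τ τ' => by simp only [map_add, LinearMap.add_apply]; abel) (fun f τ => ?_)
      (fun q => ?_) τ
    · simp only [hleib, map_add, LinearMap.add_apply, hN, hNρ σ _ _]
      module
    refine hj.determined_sec.eq (fun σ => N (br σ (j q)) e)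
      (fun σ => N σ (N (j q) e) - N (j q) (N σ e))
      (fun τ τ' => by simp only [map_add, LinearMap.add_apply])
      (fun τ τ' => by simp only [map_add, LinearMap.add_apply]; abel) (fun f τ => ?_)
      (fun p => ?_) σ
    · simp only [hleib', map_sub, LinearMap.sub_apply, hN, hNρ (j q) _ _]
      module
    simp only [hbrj, hNj, K.jacobi p q e, add_sub_cancel_right]
  -- The Jacobiator is `A`-linear in its last slot, since `ρ` preserves brackets, and it changes
  -- sign under transpositions. Each argument is moved to the last slot in turn and replaced by a
  -- prolongation.
  let Jac (σ τ υ : S) : S := br σ (br τ υ) - br (br σ τ) υ - br τ (br σ υ)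
  have hJac (σ τ υ : S) : Jac σ τ υ = br σ (br τ υ) - br (br σ τ) υ - br τ (br σ υ) := rfl
  have hJac₁₂ (σ τ υ : S) : Jac σ τ υ = -Jac τ σ υ := by
    rw [hJac, hJac, hskew σ τ, map_neg, LinearMap.neg_apply]; abel
  have hJac₂₃ (σ τ υ : S) : Jac σ τ υ = -Jac σ υ τ := by
    rw [hJac, hJac, hskew υ τ, hskew υ (br σ τ), hskew (br σ υ) τ, map_neg]; abel
  have hJadd (σ τ υ υ' : S) : Jac σ τ (υ + υ') = Jac σ τ υ + Jac σ τ υ' := by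
    simp only [hJac, map_add]; abel
  have hJsmul (σ τ υ : S) (f : A) : Jac σ τ (f • υ) = f • Jac σ τ υ := by
    simp only [hJac, hleib, map_add, hρbr, Derivation.commutator_apply]
    module
  have hJ (σ τ υ : S) : Jac σ τ υ = 0 := by
    refine hj.determined_jet (Jac σ τ) (hJadd σ τ) (fun f υ => hJsmul σ τ υ f) (fun r => ?_) υ
    rw [hJac₂₃, neg_eq_zero]
    refine hj.determined_jet (Jac σ (j r)) (hJadd σ _) (fun f υ => hJsmul σ _ υ f)
      (fun q => ?_) τ
    rw [hJac₁₂, hJac₂₃, neg_neg]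
    refine hj.determined_jet (Jac (j r) (j q)) (hJadd _ _) (fun f υ => hJsmul _ _ υ f)
      (fun p => ?_) σ
    simp only [hJac, hbrj, K.jacobi r q p, map_add]
    abel
  exact ⟨{
    bracket := br
    bracket_self := fun σ => by rw [hbr, hBself, map_zero, sub_self, sub_self]
    jacobi := fun σ τ υ => by
      have := hJ σ τ υ
      rw [hJac, sub_sub, sub_eq_zero] at this
      exact this
    anchor := ρ
    anchor_bracket := hρbr
    leibniz := hleib
    nabla := N
    nabla_smul := hN
    nabla_leibniz := fun σ f e => hNρ σ f e
    nabla_bracket := hNbr }, hNj, hρ, hbrj⟩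

end IsJetProlongation

end JetModule

/-! ## Jacobi brackets and Jacobi algebroids -/

section JacobiBracket

set_option linter.unusedSectionVars false

variable {A P S : Type*} [CommRing A] [Algebra ℝ A]
  [AddCommGroup P] [Module ℝ P] [Module A P] [Module Aᵐᵒᵖ P] [IsCentralScalar A P]

open TrivSqZeroExt

theorem Diole.isHomogeneous_inl (a : A) : Diole.IsHomogeneous 0 (inl a : Diole A P) :=
  ⟨fun h => (h rfl).elim, fun _ => rfl⟩

theorem Diole.isHomogeneous_inr (p : P) : Diole.IsHomogeneous 1 (inr p : Diole A P) :=
  ⟨fun _ => rfl, fun h => (h rfl).elim⟩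

theorem Diole.IsHomogeneous.eq_inl {x : Diole A P} (h : x.IsHomogeneous 0) : x = inl x.fst :=
  TrivSqZeroExt.ext rfl (h.2 zero_ne_one)

theorem Diole.IsHomogeneous.eq_inr {x : Diole A P} (h : x.IsHomogeneous 1) : x = inr x.snd :=
  TrivSqZeroExt.ext (h.1 one_ne_zero) rfl

theorem Diole.IsHomogeneous.cases {i : ℤ} {x : Diole A P} (h : x.IsHomogeneous i) :
    x = 0 ∨ (i = 0 ∧ ∃ a, x = inl a) ∨ (i = 1 ∧ ∃ p, x = inr p) := by
  by_cases h0 : i = 0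
  · subst h0
    exact Or.inr (Or.inl ⟨rfl, _, h.eq_inl⟩)
  by_cases h1 : i = 1
  · subst h1
    exact Or.inr (Or.inr ⟨rfl, _, h.eq_inr⟩)
  exact Or.inl (TrivSqZeroExt.ext (h.1 h0) (h.2 h1))

namespace DegNegOneJacobiBracket

variable (B : DegNegOneJacobiBracket A P)

theorem inl_inl (a b : A) : B.bracket (inl a) (inl b) = 0 := by
  have h := B.degree 0 0 _ _ (Diole.isHomogeneous_inl a) (Diole.isHomogeneous_inl b)
  exact TrivSqZeroExt.ext (h.1 (by norm_num)) (h.2 (by norm_num))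

/-- The bracket on `P` of a Jacobi bracket of degree `-1`. -/
def lie : P →ₗ[ℝ] P →ₗ[ℝ] P :=
  LinearMap.mk₂ ℝ (fun p q => (B.bracket (inr p) (inr q)).snd)
    (fun p p' q => by simp) (fun r p q => by simp) (fun p q q' => by simp)
    (fun r p q => by simp)

/-- The action of `P` on `A` of a Jacobi bracket of degree `-1`. -/
def symbol : P →ₗ[ℝ] Derivation ℝ A A where
  toFun p := Derivation.mk'
    { toFun := fun a => (B.bracket (inr p) (inl a)).fst
      map_add' := fun a b => by simp
      map_smul' := fun r a => by simp [inl_smul] } (fun a b => by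
        have h := B.derivation (inr p) (inl a) (inl b) (Diole.isHomogeneous_inr p)
        rw [← inl_mul] at h
        have h' := congrArg fst h
        simp only [fst_add, fst_mul, fst_inl] at h'
        simp only [LinearMap.coe_mk, AddHom.coe_mk, h', smul_eq_mul]
        ring)
  map_add' p q := by ext a; simp
  map_smul' r p := by ext a; simp

theorem inr_inl (p : P) (a : A) : B.bracket (inr p) (inl a) = inl (B.symbol p a) :=
  (B.degree 1 0 _ _ (Diole.isHomogeneous_inr p) (Diole.isHomogeneous_inl a)).eq_inl

theorem inr_inr (p q : P) : B.bracket (inr p) (inr q) = inr (B.lie p q) :=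
  (B.degree 1 1 _ _ (Diole.isHomogeneous_inr p) (Diole.isHomogeneous_inr q)).eq_inr

theorem inl_inr (a : A) (p : P) : B.bracket (inl a) (inr p) = -inl (B.symbol p a) := by
  have h := B.skew 0 1 _ _ (Diole.isHomogeneous_inl a) (Diole.isHomogeneous_inr p)
  rw [h, B.inr_inl]
  simp

theorem lie_smul (p : P) : IsDerivationOver (B.symbol p) (B.lie p) := by
  intro a q
  have h := B.derivation (inr p) (inl a) (inr q) (Diole.isHomogeneous_inr p)
  rw [inl_mul_inr, B.inr_inl, B.inr_inr, B.inr_inr, inl_mul_inr, inl_mul_inr, ← inr_add] at h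
  exact inr_injective h

/-- The bracket on `P` and the action of `P` on `A` of a Jacobi bracket of degree `-1`. -/
def jacobiPair : JacobiPair A P where
  lie := B.lie
  symbol := B.symbol
  skew p q := by
    have h := B.skew 1 1 _ _ (Diole.isHomogeneous_inr p) (Diole.isHomogeneous_inr q)
    rw [B.inr_inr, B.inr_inr] at h
    simpa using congrArg snd h
  jacobi p q r := by
    have h := B.jacobi 1 1 _ _ (inr r) (Diole.isHomogeneous_inr p) (Diole.isHomogeneous_inr q)
    simp only [B.inr_inr] at h
    simpa using congrArg snd h
  leibniz := B.lie_smul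
  symbol_lie p q := by
    ext a
    have h := B.jacobi 1 1 _ _ (inl a) (Diole.isHomogeneous_inr p) (Diole.isHomogeneous_inr q)
    simp only [B.inr_inr, B.inr_inl] at h
    rw [Derivation.commutator_apply, eq_sub_iff_add_eq]
    simpa using (congrArg fst h).symm
  symbol_firstOrder c a b p := by
    have h := isFirstOrderDiffOp_iff.1 (B.firstOrder (inl c)) a b (inr p)
    simp only [← inr_smul, B.inl_inr] at h
    have h' := congrArg fst h
    simp only [fst_neg, fst_add, fst_sub, fst_smul, fst_inl] at h'
    rw [← neg_inj, h']
    module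

theorem bracket_eq (x y : Diole A P) : B.bracket x y =
    inl (B.symbol x.snd y.fst - B.symbol y.snd x.fst) + inr (B.lie x.snd y.snd) := by
  conv_lhs => rw [← inl_fst_add_inr_snd_eq x, ← inl_fst_add_inr_snd_eq y]
  rw [LinearMap.map_add₂, map_add, map_add, inl_inl, B.inl_inr, B.inr_inl, B.inr_inr, inl_sub]
  abel

/-- The Leibniz rule recovers `X_p(a) q` from the bracket on `P`, and `A` acts faithfully on `P`. -/
theorem eq_of_lie {B B' : DegNegOneJacobiBracket A P}
    (hA : ∀ a : A, (∀ p : P, a • p = 0) → a = 0)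
    (h : ∀ p q, B.lie p q = B'.lie p q) : B = B' := by
  have h' (p : P) (a : A) : B.symbol p a = B'.symbol p a := by
    refine sub_eq_zero.1 (hA _ fun q => ?_)
    have := B.lie_smul p a q
    rw [h, B'.lie_smul p a q, h] at this
    rw [sub_smul, sub_eq_zero]
    exact (add_right_cancel this).symm
  apply DegNegOneJacobiBracket.ext
  refine LinearMap.ext₂ fun x y => ?_
  rw [B.bracket_eq, B'.bracket_eq, h, h', h']

end DegNegOneJacobiBracket

theorem JacobiPair.exists_degNegOneJacobiBracket (K : JacobiPair A P) :
    ∃ B : DegNegOneJacobiBracket A P, ∀ p q, B.bracket (inr p) (inr q) = inr (K.lie p q) := by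
  let br : Diole A P →ₗ[ℝ] Diole A P →ₗ[ℝ] Diole A P := LinearMap.mk₂ ℝ
    (fun x y => inl (K.symbol x.snd y.fst - K.symbol y.snd x.fst) + inr (K.lie x.snd y.snd))
    (fun x x' y => by ext <;> simp; abel) (fun r x y => by ext <;> simp [smul_sub])
    (fun x y y' => by ext <;> simp; abel) (fun r x y => by ext <;> simp [smul_sub])
  have hbr (x y : Diole A P) : br x y =
    inl (K.symbol x.snd y.fst - K.symbol y.snd x.fst) + inr (K.lie x.snd y.snd) := rfl
  have hll (a b : A) : br (inl a) (inl b) = 0 := by simp [hbr]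
  have hlr (a : A) (q : P) : br (inl a) (inr q) = -inl (K.symbol q a) := by simp [hbr]
  have hrl (q : P) (a : A) : br (inr q) (inl a) = inl (K.symbol q a) := by simp [hbr]
  have hrr (p q : P) : br (inr p) (inr q) = inr (K.lie p q) := by simp [hbr]
  have hl0 (x : Diole A P) : br 0 x = 0 := by simp
  refine ⟨{
    bracket := br
    degree := fun i k x y hx hy => ?_
    skew := fun i k x y hx hy => ?_
    jacobi := fun i k x y z hx hy => ?_
    firstOrder := fun x => ?_
    derivation := fun x y z hx => ?_ }, hrr⟩
  · rcases hx.cases with rfl | ⟨rfl, a, rfl⟩ | ⟨rfl, p, rfl⟩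
    · rw [hl0]; exact ⟨fun _ => rfl, fun _ => rfl⟩
    all_goals rcases hy.cases with rfl | ⟨rfl, b, rfl⟩ | ⟨rfl, q, rfl⟩
    all_goals simp [Diole.IsHomogeneous, hll, hlr, hrl, hrr]
  -- The sign `(-1)^((i-1)(j-1))` is `-1` only for two elements of `A`, whose bracket is zero.
  · rcases hx.cases with rfl | ⟨rfl, a, rfl⟩ | ⟨rfl, p, rfl⟩
    · simp
    all_goals rcases hy.cases with rfl | ⟨rfl, b, rfl⟩ | ⟨rfl, q, rfl⟩
    all_goals simp [hll, hlr, hrl, hrr]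
    rw [K.skew p q, inr_neg]
  · rcases hx.cases with rfl | ⟨rfl, a, rfl⟩ | ⟨rfl, p, rfl⟩
    · simp
    all_goals rcases hy.cases with rfl | ⟨rfl, b, rfl⟩ | ⟨rfl, q, rfl⟩
    all_goals rw [← inl_fst_add_inr_snd_eq z]
    all_goals simp [hll, hlr, hrl, hrr, K.symbol_lie, Derivation.commutator_apply]
    · abel
    · abel
    · rw [K.jacobi, inr_add]; abel
  · rw [isFirstOrderDiffOp_iff]
    intro a b y
    have h1 := K.symbol_firstOrder x.fst a b y.snd
    ext
    · simp [hbr, h1]; ring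
    · simp [hbr, K.leibniz _ _ _]; module
  · rw [hx.eq_inr]
    ext
    · simp [hbr]; ring
    · simp [hbr, K.leibniz _ _ _]; module

end JacobiBracket

/-! ### From Jacobi algebroids back to brackets, and the abstract bijection -/

section JacobiAlgebroid

variable {A P S : Type*} [CommRing A] [Algebra ℝ A]
  [AddCommGroup P] [Module ℝ P] [Module A P] [AddCommGroup S] [Module ℝ S] [Module A S]
  {j : P →ₗ[ℝ] S}

/-- The Lie algebra structure `{p, q} = ∇_{j p} q` of a Jacobi algebroid structure with
`[j p, j q] = j (∇_{j p} q)`. -/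
theorem JacobiAlgebroidStructure.exists_jacobiPair (hj : IsJetProlongation A j)
    [IsScalarTower ℝ A S] (J : JacobiAlgebroidStructure A S P)
    (hJ : ∀ p q, J.bracket (j p) (j q) = j (J.nabla (j p) q)) :
    ∃ K : JacobiPair A P, ∀ p q, K.lie p q = J.nabla (j p) q := by
  -- Skew-symmetry of `∇_{j p} q` is inherited from the algebroid bracket because `j` is injective.
  have hskew (p q : P) : J.nabla (j p) q = -J.nabla (j q) p := by
    apply hj.injective
    rw [map_neg, ← hJ, ← hJ]
    have := J.bracket_self (j p + j q)
    simp only [map_add, LinearMap.add_apply, J.bracket_self, zero_add, add_zero] at this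
    rw [add_comm] at this
    exact eq_neg_of_add_eq_zero_left this
  refine ⟨{
    lie := J.nabla ∘ₗ j
    symbol := (J.anchor.restrictScalars ℝ) ∘ₗ j
    skew := hskew
    jacobi := fun p q r => ?_
    leibniz := fun p a q => J.nabla_leibniz (j p) a q
    symbol_lie := fun p q => ?_
    symbol_firstOrder := fun c a b p => ?_ }, fun p q => rfl⟩
  · have := J.nabla_bracket (j p) (j q) r
    rw [hJ] at this
    simp only [LinearMap.comp_apply, this, sub_add_cancel]
  · simp only [LinearMap.comp_apply, LinearMap.restrictScalars_apply, ← hJ, J.anchor_bracket]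
  · simp only [LinearMap.comp_apply, LinearMap.restrictScalars_apply, hj.jet_smul_smul a b,
      map_add, map_sub, map_smul, Derivation.add_apply, Derivation.sub_apply,
      Derivation.smul_apply]

theorem JacobiAlgebroidStructure.bracket_smul_left {J : JacobiAlgebroidStructure A S P}
    (f : A) (σ τ : S) : J.bracket (f • σ) τ = f • J.bracket σ τ - J.anchor τ f • σ := by
  have hskew (σ τ : S) : J.bracket σ τ = -J.bracket τ σ := by
    have := J.bracket_self (σ + τ)
    simp only [map_add, LinearMap.add_apply, J.bracket_self, zero_add, add_zero] at this
    rw [add_comm] at this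
    exact eq_neg_of_add_eq_zero_left this
  rw [hskew, J.leibniz, hskew σ τ]
  module

/-- `∇` is `A`-linear in its first argument, hence fixed by its values on prolongations. It fixes
the anchor by faithfulness, and then the Leibniz rule in both slots fixes the bracket. -/
theorem JacobiAlgebroidStructure.eq_of_nabla (hj : IsJetProlongation A j)
    {J J' : JacobiAlgebroidStructure A S P}
    (hJ : ∀ p q, J.bracket (j p) (j q) = j (J.nabla (j p) q))
    (hJ' : ∀ p q, J'.bracket (j p) (j q) = j (J'.nabla (j p) q))
    (h : ∀ p q, J.nabla (j p) q = J'.nabla (j p) q) : J = J' := by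
  have hnabla (σ : S) (e : P) : J.nabla σ e = J'.nabla σ e :=
    hj.determined_sec.eq (fun σ => J.nabla σ e) (fun σ => J'.nabla σ e)
      (fun σ τ => by simp only [map_add, LinearMap.add_apply])
      (fun σ τ => by simp only [map_add, LinearMap.add_apply])
      (fun f σ => by simp only [J.nabla_smul, J'.nabla_smul, smul_sub]) (fun p => h p e) σ
  have hanchor (σ : S) (a : A) : J.anchor σ a = J'.anchor σ a := by
    refine sub_eq_zero.1 (hj.faithful _ fun e => ?_)
    have h1 := J.nabla_leibniz σ a e
    rw [hnabla, hnabla, J'.nabla_leibniz] at h1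
    rw [sub_smul, sub_eq_zero]
    exact (add_right_cancel h1).symm
  have hbracket (σ τ : S) : J.bracket σ τ = J'.bracket σ τ := by
    refine hj.determined_jet.eq (J.bracket σ) (J'.bracket σ) (map_add _) (map_add _)
      (fun f τ => by rw [J.leibniz, J'.leibniz, hanchor]; module) (fun q => ?_) τ
    refine hj.determined_jet.eq (fun σ => J.bracket σ (j q)) (fun σ => J'.bracket σ (j q))
      (fun σ τ => by simp only [map_add, LinearMap.add_apply])
      (fun σ τ => by simp only [map_add, LinearMap.add_apply])
      (fun f σ => by simp only [bracket_smul_left, hanchor]; module)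
      (fun p => by simp only [hJ, hJ', h]) σ
  exact JacobiAlgebroidStructure.ext (LinearMap.ext₂ hbracket)
    (LinearMap.ext fun σ => Derivation.ext (hanchor σ)) (LinearMap.ext₂ hnabla)

open TrivSqZeroExt in
theorem IsJetProlongation.exists_equiv [Module Aᵐᵒᵖ P] [IsCentralScalar A P]
    [IsScalarTower ℝ A P] [IsScalarTower ℝ A S] (hj : IsJetProlongation A j) :
    ∃ e : DegNegOneJacobiBracket A P ≃ {J : JacobiAlgebroidStructure A S P //
        ∀ p q, J.bracket (j p) (j q) = j (J.nabla (j p) q)},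
      ∀ B : DegNegOneJacobiBracket A P,
        (∀ p q, B.bracket (inr p) (inr q) = inr ((e B).1.nabla (j p) q)) ∧
        (∀ p a, B.bracket (inr p) (inl a) = inl ((e B).1.anchor (j p) a)) ∧
        ∀ J : {J : JacobiAlgebroidStructure A S P //
            ∀ p q, J.bracket (j p) (j q) = j (J.nabla (j p) q)},
          (∀ p q, B.bracket (inr p) (inr q) = inr (J.1.nabla (j p) q)) → J = e B := by
  have hex (B : DegNegOneJacobiBracket A P) : ∃ J : {J : JacobiAlgebroidStructure A S P //
        ∀ p q, J.bracket (j p) (j q) = j (J.nabla (j p) q)},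
      (∀ p q, B.bracket (inr p) (inr q) = inr (J.1.nabla (j p) q)) ∧
      ∀ p a, B.bracket (inr p) (inl a) = inl (J.1.anchor (j p) a) := by
    obtain ⟨J, h₁, h₂, h₃⟩ := hj.exists_jacobiAlgebroidStructure B.jacobiPair
    exact ⟨⟨J, fun p q => by rw [h₃, h₁]⟩, fun p q => by rw [B.inr_inr, h₁]; rfl,
      fun p a => by rw [B.inr_inl, h₂]; rfl⟩
  choose F hF hF' using hex
  have huniq (B : DegNegOneJacobiBracket A P) (J : {J : JacobiAlgebroidStructure A S P //
        ∀ p q, J.bracket (j p) (j q) = j (J.nabla (j p) q)})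
      (h : ∀ p q, B.bracket (inr p) (inr q) = inr (J.1.nabla (j p) q)) : J = F B :=
    Subtype.ext <| JacobiAlgebroidStructure.eq_of_nabla hj J.2 (F B).2 fun p q =>
      inr_injective <| (h p q).symm.trans (hF B p q)
  refine ⟨Equiv.ofBijective F ⟨fun B B' h => ?_, fun J => ?_⟩, fun B => ⟨hF B, hF' B, huniq B⟩⟩
  · exact DegNegOneJacobiBracket.eq_of_lie hj.faithful fun p q =>
      inr_injective <| by rw [← B.inr_inr, ← B'.inr_inr, hF, hF, h]
  · obtain ⟨K, hK⟩ := J.1.exists_jacobiPair hj J.2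
    obtain ⟨B, hB⟩ := K.exists_degNegOneJacobiBracket
    exact ⟨B, (huniq B J fun p q => by rw [hB, hK]).symm⟩

end JacobiAlgebroid

/-! ## Hadamard's lemma -/

section Hadamard

variable {E : Type*} [NormedAddCommGroup E] [NormedSpace ℝ E]

open MeasureTheory Set in
-- The integral is a convolution, evaluated at `0`, of the indicator of `(0, 1]` with a compactly
-- supported function depending smoothly on the parameter `z`.
theorem contDiff_integral_segment {F : Type*} [NormedAddCommGroup F] [NormedSpace ℝ F]
    {g : E → F} (hg : ContDiff ℝ ∞ g) (z₀ : E) :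
    ContDiff ℝ ∞ fun z => ∫ t in (0 : ℝ)..1, g (z₀ + t • (z - z₀)) := by
  let b : ContDiffBump (0 : ℝ) := ⟨2, 3, by norm_num, by norm_num⟩
  let f : ℝ → ℝ := indicator (Ioc 0 1) fun _ => 1
  have hf : LocallyIntegrable f volume := by
    refine ((integrable_indicator_iff measurableSet_Ioc).2 ?_).locallyIntegrable
    exact integrableOn_const (by simp)
  -- Convolution at `0` evaluates `G z` at `-t`, whence the minus sign. The bump is `1` there, since
  -- `|t| ≤ 1 < 2`, and supplies compact support in `s`.
  let G : E → ℝ → F := fun z s => b s • g (z₀ - s • (z - z₀))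
  have hG : ContDiff ℝ ∞ ↿G := by
    refine ContDiff.smul (b.contDiff.comp contDiff_snd) (hg.comp ?_)
    fun_prop
  have := contDiffOn_convolution_right_with_param (μ := volume) (n := ⊤)
    (ContinuousLinearMap.lsmul ℝ ℝ : ℝ →L[ℝ] F →L[ℝ] F) isOpen_univ
    (isCompact_closedBall (0 : ℝ) 3) (g := G) (s := univ) (fun p x _ hx => ?_) hf hG.contDiffOn
  · rw [univ_prod_univ, contDiffOn_univ] at this
    have h0 := this.comp (contDiff_id.prodMk (contDiff_const (c := (0 : ℝ))))
    convert h0 using 1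
    ext z
    simp only [Function.comp_apply, id_eq, MeasureTheory.convolution]
    rw [intervalIntegral.integral_of_le zero_le_one, ← integral_indicator measurableSet_Ioc]
    congr 1
    ext t
    by_cases ht : t ∈ Ioc (0 : ℝ) 1
    · have hb : b (-t) = 1 := b.one_of_mem_closedBall (by
        simp only [Metric.mem_closedBall, dist_zero_right, norm_neg, Real.norm_eq_abs, b]
        rw [abs_of_pos ht.1]; linarith [ht.2])
      simp [f, G, ht, hb]
    · simp [f, ht]
  · have hb : b x = 0 := b.zero_of_le_dist (by
      simpa [b] using (not_le.1 (fun h => hx (Metric.mem_closedBall.2 h))).le)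
    simp [G, hb]

/-- `H z` is the average of the derivative of `g` over the segment from `z₀` to `z`. -/
theorem hadamard {g : E → ℝ} (hg : ContDiff ℝ ∞ g) (z₀ : E) :
    ∃ H : E → E →L[ℝ] ℝ, ContDiff ℝ ∞ H ∧ H z₀ = fderiv ℝ g z₀ ∧
      ∀ z, g z = g z₀ + H z (z - z₀) := by
  have hg' : ContDiff ℝ ∞ (fderiv ℝ g) := hg.fderiv_right (by simp)
  refine ⟨_, contDiff_integral_segment hg' z₀, by simp, fun z => ?_⟩
  have hd (t : ℝ) : HasDerivAt (fun t : ℝ => g (z₀ + t • (z - z₀)))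
      (fderiv ℝ g (z₀ + t • (z - z₀)) (z - z₀)) t := by
    have h1 : HasDerivAt (fun t : ℝ => z₀ + t • (z - z₀)) (z - z₀) t := by
      simpa using ((hasDerivAt_id t).smul_const (z - z₀)).const_add z₀
    exact ((hg.differentiable (by simp) _).hasFDerivAt).comp_hasDerivAt t h1
  have hc : Continuous fun t : ℝ => fderiv ℝ g (z₀ + t • (z - z₀)) :=
    hg'.continuous.comp (by fun_prop)
  rw [ContinuousLinearMap.intervalIntegral_apply (hc.intervalIntegrable _ _),
    intervalIntegral.integral_eq_sub_of_hasDerivAt (fun t _ => hd t)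
      ((hc.clm_apply continuous_const).intervalIntegrable _ _)]
  simp

end Hadamard

/-! ## Smooth functions near a point -/

section SmoothFunctions

variable {E : Type*} [NormedAddCommGroup E] [NormedSpace ℝ E] {M : Type*} [TopologicalSpace M]
  [ChartedSpace E M]

theorem mem_vanishingIdeal {x : M} {f : SmoothFun E M} : f ∈ vanishingIdeal E x ↔ f x = 0 :=
  Iff.rfl

theorem SmoothFun.exists_eq_mul_of_tsupport {χ : SmoothFun E M} {U : Set M} (hU : IsOpen U)
    (hχ : tsupport χ ⊆ U) {g : M → ℝ} (hg : ContMDiffOn 𝓘(ℝ, E) 𝓘(ℝ, ℝ) ∞ g U) :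
    ∃ u : SmoothFun E M, ∀ y, u y = χ y * g y := by
  refine ⟨⟨fun y => χ y * g y, contMDiff_of_tsupport fun y hy => ?_⟩, fun y => rfl⟩
  have hy' : y ∈ U := hχ (closure_mono (Function.support_mul_subset_left _ _) hy)
  exact χ.contMDiff.contMDiffAt.mul (hg.contMDiffAt (hU.mem_nhds hy'))

variable [FiniteDimensional ℝ E] [T2Space M] [IsManifold 𝓘(ℝ, E) ∞ M]

theorem SmoothFun.exists_bump {x : M} {U : Set M} (hU : U ∈ 𝓝 x) :
    ∃ χ : SmoothFun E M, (∀ᶠ y in 𝓝 x, χ y = 1) ∧ tsupport χ ⊆ U := by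
  obtain ⟨f, -, hf⟩ :=
    (SmoothBumpFunction.nhds_basis_tsupport (I := 𝓘(ℝ, E)) x).mem_iff.1 hU
  exact ⟨⟨f, f.contMDiff⟩, f.eventuallyEq_one, hf⟩

/-- A bump function whose support lies in a neighbourhood on which `P` holds. -/
theorem SmoothFun.exists_bump_of_eventually {x : M} {P : M → Prop} (hP : ∀ᶠ y in 𝓝 x, P y) :
    ∃ χ : SmoothFun E M, (∀ᶠ y in 𝓝 x, χ y = 1) ∧ ∀ y, χ y = 0 ∨ P y := by
  obtain ⟨χ, h₁, h₂⟩ := SmoothFun.exists_bump (E := E) hP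
  refine ⟨χ, h₁, fun y => or_iff_not_imp_left.2 fun hy => h₂ (subset_tsupport _ hy)⟩

omit [FiniteDimensional ℝ E] [T2Space M] in
theorem SmoothFun.contDiffOn_comp_extChartAt_symm (u : SmoothFun E M) (x : M) :
    ContDiffOn ℝ ∞ (u ∘ (extChartAt 𝓘(ℝ, E) x).symm) (extChartAt 𝓘(ℝ, E) x).target :=
  (u.contMDiff.comp_contMDiffOn (contMDiffOn_extChartAt_symm x)).contDiffOn

omit [FiniteDimensional ℝ E] [T2Space M] in
-- This is the cut-off coordinate field `χ ∂_v`; such fields detect all first derivatives at `x`.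
theorem SmoothFun.exists_derivation {x : M} {χ : SmoothFun E M}
    (hχ : tsupport χ ⊆ (extChartAt 𝓘(ℝ, E) x).source) (v : E) :
    ∃ V : Derivation ℝ (SmoothFun E M) (SmoothFun E M), ∀ u y, V u y =
      χ y * fderiv ℝ (u ∘ (extChartAt 𝓘(ℝ, E) x).symm) (extChartAt 𝓘(ℝ, E) x y) v := by
  have hV (u : SmoothFun E M) : ∃ w : SmoothFun E M, ∀ y, w y =
      χ y * fderiv ℝ (u ∘ (extChartAt 𝓘(ℝ, E) x).symm) (extChartAt 𝓘(ℝ, E) x y) v := by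
    refine exists_eq_mul_of_tsupport (isOpen_extChartAt_source x) hχ ?_
    have h1 := ((u.contDiffOn_comp_extChartAt_symm x).fderiv_of_isOpen
      (isOpen_extChartAt_target x) (m := ∞) (by simp)).clm_apply (contDiffOn_const (c := v))
    refine h1.contMDiffOn.comp ?_ (extChartAt 𝓘(ℝ, E) x).mapsTo
    rw [extChartAt_source]
    exact contMDiffOn_extChartAt
  choose V hV using hV
  have hd (u : SmoothFun E M) {y : M} (hy : χ y ≠ 0) : DifferentiableAt ℝ
      (u ∘ (extChartAt 𝓘(ℝ, E) x).symm) (extChartAt 𝓘(ℝ, E) x y) :=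
    ((u.contDiffOn_comp_extChartAt_symm x).contDiffAt ((isOpen_extChartAt_target x).mem_nhds
      ((extChartAt 𝓘(ℝ, E) x).mapsTo (hχ (subset_tsupport _ hy))))).differentiableAt (by simp)
  refine ⟨Derivation.mk'
    { toFun := V
      map_add' := fun u w => ContMDiffMap.ext fun y => ?_
      map_smul' := fun r u => ContMDiffMap.ext fun y => ?_ } (fun u w => ContMDiffMap.ext
      fun y => ?_), hV⟩
  · change V (u + w) y = V u y + V w y
    by_cases hy : χ y = 0
    · simp [hV, hy]
    have : ⇑(u + w) ∘ (extChartAt 𝓘(ℝ, E) x).symm = u ∘ (extChartAt 𝓘(ℝ, E) x).symm +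
      w ∘ (extChartAt 𝓘(ℝ, E) x).symm := rfl
    rw [hV, hV, hV, this, fderiv_add (hd u hy) (hd w hy), add_apply, mul_add]
  · change V (r • u) y = r * V u y
    by_cases hy : χ y = 0
    · simp [hV, hy]
    have : ⇑(r • u) ∘ (extChartAt 𝓘(ℝ, E) x).symm = r • (u ∘ (extChartAt 𝓘(ℝ, E) x).symm) := rfl
    rw [hV, hV, this, fderiv_const_smul (hd u hy), smul_apply, smul_eq_mul]
    ring
  · change V (u * w) y = u y * V w y + w y * V u y
    by_cases hy : χ y = 0
    · simp [hV, hy]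
    have : ⇑(u * w) ∘ (extChartAt 𝓘(ℝ, E) x).symm = (u ∘ (extChartAt 𝓘(ℝ, E) x).symm) *
      (w ∘ (extChartAt 𝓘(ℝ, E) x).symm) := rfl
    rw [hV, hV, hV, this, fderiv_mul (hd u hy) (hd w hy)]
    simp only [add_apply, smul_apply, smul_eq_mul,
      Function.comp_apply, (extChartAt 𝓘(ℝ, E) x).left_inv (hχ (subset_tsupport _ hy))]
    ring

/-- A smooth function that vanishes at `x` together with its first derivatives lies in `μ_x²`. -/
theorem SmoothFun.mem_sq_vanishingIdeal {x : M} {u : SmoothFun E M} (h₀ : u x = 0)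
    (h₁ : fderiv ℝ (u ∘ (extChartAt 𝓘(ℝ, E) x).symm) (extChartAt 𝓘(ℝ, E) x x) = 0) :
    u ∈ vanishingIdeal E x ^ 2 := by
  set φ := extChartAt 𝓘(ℝ, E) x with hφ
  have hx : x ∈ φ.source := mem_extChartAt_source x
  have htgt : φ.target ∈ 𝓝 (φ x) := extChartAt_target_mem_nhds x
  obtain ⟨r, hr, hrt⟩ := Metric.nhds_basis_closedBall.mem_iff.1 htgt
  let b : ContDiffBump (φ x) := ⟨r / 2, r, by positivity, by linarith⟩
  let g : E → ℝ := fun z => b z * u (φ.symm z)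
  have hg : ContDiff ℝ ∞ g := by
    rw [contDiff_iff_contDiffAt]
    intro z
    by_cases hz : z ∈ φ.target
    · exact b.contDiffAt.mul ((u.contDiffOn_comp_extChartAt_symm x).contDiffAt
        ((isOpen_extChartAt_target x).mem_nhds hz))
    · have hz' : z ∉ tsupport b := by
        rw [b.tsupport_eq]; exact fun h => hz (hrt h)
      have : g =ᶠ[𝓝 z] fun _ => 0 := by
        filter_upwards [notMem_tsupport_iff_eventuallyEq.1 hz'] with w hw
        simp [g, hw]
      exact contDiffAt_const.congr_of_eventuallyEq this
  have hgu : g =ᶠ[𝓝 (φ x)] u ∘ φ.symm := by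
    filter_upwards [b.eventuallyEq_one] with z hz
    simp [g, hz]
  obtain ⟨H, hH, hH₀, hgH⟩ := hadamard hg (φ x)
  rw [hgu.fderiv_eq, h₁] at hH₀
  have hg₀ : g (φ x) = 0 := by rw [hgu.self_of_nhds, Function.comp_apply, φ.left_inv hx, h₀]
  have hU : ∀ᶠ y in 𝓝 x, y ∈ φ.source ∧ g (φ y) = u y := by
    filter_upwards [(continuousAt_extChartAt (I := 𝓘(ℝ, E)) x).eventually hgu,
      extChartAt_source_mem_nhds (I := 𝓘(ℝ, E)) x] with y hy hys
    refine ⟨hys, ?_⟩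
    rw [hy, Function.comp_apply, φ.left_inv hys]
  obtain ⟨χ, hχ, hχU⟩ := exists_bump (E := E) (x := x) hU
  have hχx : χ x = 1 := hχ.self_of_nhds
  have hχs : tsupport χ ⊆ φ.source := fun y hy => (hχU hy).1
  have hφs : ContMDiffOn 𝓘(ℝ, E) 𝓘(ℝ, E) ∞ φ φ.source := by
    rw [hφ, extChartAt_source]; exact contMDiffOn_extChartAt
  let B := Module.finBasis ℝ E
  have hc (i) : ∃ c : SmoothFun E M, ∀ y, c y = χ y * B.coord i (φ y - φ x) := by
    refine exists_eq_mul_of_tsupport (isOpen_extChartAt_source x) hχs ?_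
    have : ContDiff ℝ ∞ fun z => (B.coord i).toContinuousLinearMap (z - φ x) := by fun_prop
    exact this.contMDiff.comp_contMDiffOn hφs
  have hh (i) : ∃ c : SmoothFun E M, ∀ y, c y = χ y * H (φ y) (B i) := by
    refine exists_eq_mul_of_tsupport (isOpen_extChartAt_source x) hχs ?_
    have : ContDiff ℝ ∞ fun z => H z (B i) := hH.clm_apply contDiff_const
    exact this.contMDiff.comp_contMDiffOn hφs
  choose c hc using hc
  choose h hh using hh
  -- Hadamard's formula in the chart, expanded in a basis of `E`; one factor `χ` globalises the
  -- coordinate and the other its coefficient. Both factors vanish at `x`.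
  have hsum : χ ^ 2 * u = ∑ i, c i * h i := by
    ext y
    have e1 : (∑ i, c i * h i : SmoothFun E M) y = ∑ i, c i y * h i y := by
      change ContMDiffMap.evalRingHom y (∑ i, c i * h i) = _
      rw [map_sum]
      rfl
    have e2 : (χ ^ 2 * u) y = χ y ^ 2 * u y := rfl
    rw [e1, e2]
    by_cases hy : χ y = 0
    · simp [hc, hy]
    rw [← (hχU (subset_tsupport _ hy)).2, hgH, hg₀, zero_add]
    conv_lhs => rw [← B.sum_repr (φ y - φ x)]
    rw [map_sum, Finset.mul_sum]
    refine Finset.sum_congr rfl fun i _ => ?_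
    rw [map_smul, hc, hh, smul_eq_mul, B.coord_apply]
    ring
  have hu : u = ∑ i, c i * h i + (1 - χ ^ 2) * u := by rw [← hsum]; ring
  rw [hu, sq (vanishingIdeal E x)]
  refine Ideal.add_mem _ (Ideal.sum_mem _ fun i _ => Ideal.mul_mem_mul ?_ ?_)
    (Ideal.mul_mem_mul ?_ h₀)
  · rw [mem_vanishingIdeal, hc]; simp
  · rw [mem_vanishingIdeal, hh, hH₀]; simp
  · rw [mem_vanishingIdeal]
    change 1 - χ x ^ 2 = 0
    rw [hχx]; norm_num

end SmoothFunctions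

/-! ## Sections of a line bundle and of its jet bundle -/

section JetBundle

variable {E : Type*} [NormedAddCommGroup E] [NormedSpace ℝ E] {M : Type*} [TopologicalSpace M]
  [ChartedSpace E M] {L : M → Type*} [TopologicalSpace (Bundle.TotalSpace ℝ L)]
  [∀ x, AddCommGroup (L x)] [∀ x, Module ℝ (L x)] [∀ x, TopologicalSpace (L x)]
  [FiberBundle ℝ L] [VectorBundle ℝ ℝ L]

instance LineSec.instIsScalarTower : IsScalarTower ℝ (SmoothFun E M) (LineSec E L) where
  smul_assoc r f s := ContMDiffSection.ext fun x => mul_smul r (f x) (s x)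

instance JetSec.instIsScalarTower : IsScalarTower ℝ (SmoothFun E M) (JetSec E L) where
  smul_assoc r f σ := Subtype.ext <| funext fun x => mul_smul r (f x) (σ.1 x)

/-- Evaluation of sections of `L` at `x`. -/
def LineSec.eval (x : M) : LineSec E L →ₗ[ℝ] L x where
  toFun s := s x
  map_add' _ _ := rfl
  map_smul' _ _ := rfl

/-- Evaluation of sections of `J¹L` at `x`. -/
def JetSec.eval (x : M) : JetSec E L →ₗ[ℝ] JetFiber E L x where
  toFun σ := σ.1 x
  map_add' _ _ := rfl
  map_smul' _ _ := rfl

/-- Evaluation of smooth functions at `x`. -/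
def SmoothFun.eval (x : M) : SmoothFun E M →ₗ[ℝ] ℝ where
  toFun f := f x
  map_add' _ _ := rfl
  map_smul' _ _ := rfl

theorem jetAt_eq_zero_of_mem {x : M} {s : LineSec E L}
    (hs : s ∈ (vanishingIdeal E x ^ 2 • (⊤ : Submodule (SmoothFun E M) (LineSec E L)) :
      Submodule (SmoothFun E M) (LineSec E L))) : jetAt x s = 0 :=
  (Submodule.Quotient.mk_eq_zero _).2 (Submodule.subset_span hs)

/-- A first order operator annihilates, at `x`, the sections that vanish to first order at `x`. -/
theorem vanishingToFirstOrder_le_ker {Q V : Type*} [AddCommGroup Q] [Module ℝ Q]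
    [Module (SmoothFun E M) Q] [AddCommGroup V] [Module ℝ V] {x : M} (ev : Q →ₗ[ℝ] V)
    (hev : ∀ (f : SmoothFun E M) q, ev (f • q) = f x • ev q) {D : LineSec E L →ₗ[ℝ] Q}
    (hD : IsFirstOrderDiffOp (SmoothFun E M) D) :
    vanishingToFirstOrder E L x ≤ LinearMap.ker (ev ∘ₗ D) := by
  refine Submodule.span_le.2 fun s hs => ?_
  change ev (D s) = 0
  refine Submodule.smul_induction_on (p := fun s => ev (D s) = 0) hs (fun f hf s _ => ?_)
    fun s t hs ht => by rw [map_add, map_add, hs, ht, add_zero]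
  rw [sq] at hf
  refine Submodule.mul_induction_on (C := fun f => ev (D (f • s)) = 0) hf
    (fun a ha b hb => ?_) fun f g hf hg => by rw [add_smul, map_add, map_add, hf, hg, add_zero]
  have ha' : a x = 0 := ha
  have hb' : b x = 0 := hb
  rw [mul_smul, isFirstOrderDiffOp_iff.1 hD, mul_smul]
  simp [hev, ha', hb']

/-- The section `∑ f_i • j₁ s_i` of `J¹L`. -/
def jetCombination : (LineSec E L →₀ SmoothFun E M) →+ JetSec E L :=
  Finsupp.liftAddHom fun s => (smulAddHom (SmoothFun E M) (JetSec E L)).flip (jetProlongation s)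

theorem jetCombination_single (s : LineSec E L) (f : SmoothFun E M) :
    jetCombination (Finsupp.single s f) = f • jetProlongation s := by
  simp [jetCombination]

theorem jetCombination_smul (f : SmoothFun E M) (c : LineSec E L →₀ SmoothFun E M) :
    jetCombination (f • c) = f • jetCombination c := by
  induction c using Finsupp.induction_linear with
  | zero => simp
  | add c d hc hd => rw [smul_add, map_add, hc, hd, map_add, smul_add]
  | single s g => rw [Finsupp.smul_single, jetCombination_single, jetCombination_single,
      smul_assoc]

theorem jetCombination_eval (c : LineSec E L →₀ SmoothFun E M) (x : M) :
    (jetCombination c).1 x = c.sum fun s f => f x • jetAt x s := by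
  change JetSec.eval x (jetCombination c) = _
  rw [jetCombination, Finsupp.liftAddHom_apply, map_finsuppSum]
  rfl

theorem JetSec.exists_eventually_eq (σ : JetSec E L) (x : M) :
    ∃ c : LineSec E L →₀ SmoothFun E M, ∀ᶠ y in 𝓝 x, σ.1 y = (jetCombination c).1 y := by
  obtain ⟨c, hc⟩ := σ.2 x
  exact ⟨c, by simpa only [jetCombination_eval] using hc⟩

/-- A first order operator `D` factors through the jets at `x`. -/
theorem exists_jetFiber_lift {Q V : Type*} [AddCommGroup Q] [Module ℝ Q]
    [Module (SmoothFun E M) Q] [AddCommGroup V] [Module ℝ V] {x : M} (ev : Q →ₗ[ℝ] V)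
    (hev : ∀ (f : SmoothFun E M) q, ev (f • q) = f x • ev q) {D : LineSec E L →ₗ[ℝ] Q}
    (hD : IsFirstOrderDiffOp (SmoothFun E M) D) :
    ∃ T : JetFiber E L x →ₗ[ℝ] V, (∀ s, T (jetAt x s) = ev (D s)) ∧
      ∀ c : LineSec E L →₀ SmoothFun E M,
        T ((jetCombination c).1 x) = ev (c.sum fun s f => f • D s) := by
  obtain ⟨T, hT⟩ : ∃ T : JetFiber E L x →ₗ[ℝ] V, ∀ s, T (jetAt x s) = ev (D s) :=
    ⟨(vanishingToFirstOrder E L x).liftQ (ev ∘ₗ D) (vanishingToFirstOrder_le_ker ev hev hD),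
      fun s => Submodule.liftQ_apply _ _ _⟩
  refine ⟨T, hT, fun c => ?_⟩
  rw [jetCombination_eval, map_finsuppSum, map_finsuppSum]
  refine Finsupp.sum_congr fun s _ => ?_
  rw [map_smul, hev, hT]

/-- `T` is built fibre by fibre, so `T σ x` depends only on the value of `σ` at `x`; smoothness is
read off a local presentation of `σ`. -/
theorem exists_lift_fun {D : LineSec E L →ₗ[ℝ] SmoothFun E M}
    (hD : IsFirstOrderDiffOp (SmoothFun E M) D) :
    ∃ T : JetSec E L →ₗ[SmoothFun E M] SmoothFun E M,
      ∀ (σ : JetSec E L) (x : M) (s : LineSec E L), σ.1 x = jetAt x s → T σ x = D s x := by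
  choose T hT hT' using fun x : M => exists_jetFiber_lift (SmoothFun.eval x)
    (fun f q => rfl) hD
  refine ⟨{ toFun := fun σ => ⟨fun x => T x (σ.1 x), fun x => ?_⟩
            map_add' := fun σ τ => ContMDiffMap.ext fun x => map_add (T x) _ _
            map_smul' := fun f σ => ContMDiffMap.ext fun x => map_smul (T x) _ _ },
    fun σ x s h => ?_⟩
  · obtain ⟨c, hc⟩ := σ.exists_eventually_eq x
    refine (c.sum fun s f => f • D s).contMDiff.contMDiffAt.congr_of_eventuallyEq ?_
    filter_upwards [hc] with y hy
    rw [hy, hT']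
    rfl
  · exact (congrArg (T x) h).trans (hT x s)

theorem exists_lift_sec {D : LineSec E L →ₗ[ℝ] LineSec E L}
    (hD : IsFirstOrderDiffOp (SmoothFun E M) D) :
    ∃ T : JetSec E L →ₗ[SmoothFun E M] LineSec E L,
      ∀ (σ : JetSec E L) (x : M) (s : LineSec E L), σ.1 x = jetAt x s → T σ x = D s x := by
  choose T hT hT' using fun x : M => exists_jetFiber_lift (LineSec.eval x)
    (fun f q => rfl) hD
  refine ⟨{ toFun := fun σ => ⟨fun x => T x (σ.1 x), fun x => ?_⟩
            map_add' := fun σ τ => ContMDiffSection.ext fun x => map_add (T x) _ _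
            map_smul' := fun f σ => ContMDiffSection.ext fun x => map_smul (T x) _ _ },
    fun σ x s h => ?_⟩
  · obtain ⟨c, hc⟩ := σ.exists_eventually_eq x
    refine (c.sum fun s f => f • D s).contMDiff.contMDiffAt.congr_of_eventuallyEq ?_
    filter_upwards [hc] with y hy
    rw [hy, hT']
    rfl
  · exact (congrArg (T x) h).trans (hT x s)

theorem jetProlongation_injective :
    Function.Injective (jetProlongation : LineSec E L →ₗ[ℝ] JetSec E L) := by
  rw [injective_iff_map_eq_zero]
  intro s hs
  obtain ⟨T, hT⟩ := exists_lift_sec (D := (LinearMap.id : LineSec E L →ₗ[ℝ] LineSec E L))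
    (isFirstOrderDiffOp_iff.2 fun a b p => by simp only [LinearMap.id_apply]; module)
  ext x
  rw [← LinearMap.id_apply (R := ℝ) s, ← hT (jetProlongation s) x s rfl, hs, map_zero]

theorem isFirstOrderDiffOp_jetProlongation :
    IsFirstOrderDiffOp (SmoothFun E M) (jetProlongation : LineSec E L →ₗ[ℝ] JetSec E L) := by
  rw [isFirstOrderDiffOp_iff]
  intro a b p
  refine Subtype.ext <| funext fun x => ?_
  change jetAt x (a • b • p) =
    a x • jetAt x (b • p) + b x • jetAt x (a • p) - (a x * b x) • jetAt x p
  let a₀ : SmoothFun E M := algebraMap ℝ _ (a x)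
  let b₀ : SmoothFun E M := algebraMap ℝ _ (b x)
  -- The product `(a - a(x)) (b - b(x))` lies in `μ_x²`; expanding it gives the first order identity
  -- at `x`.
  have h : jetAt x (((a - a₀) * (b - b₀)) • p) = 0 := by
    refine jetAt_eq_zero_of_mem (Submodule.smul_mem_smul ?_ trivial)
    rw [sq]
    exact Ideal.mul_mem_mul (sub_self (a x)) (sub_self (b x))
  have h' : ((a - a₀) * (b - b₀)) • p =
      a • b • p - a x • (b • p) - b x • (a • p) + (a x * b x) • p := by
    simp only [← algebraMap_smul (SmoothFun E M) (a x), ← algebraMap_smul (SmoothFun E M) (b x),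
      ← algebraMap_smul (SmoothFun E M) (a x * b x), map_mul]
    module
  rw [h', map_add, map_sub, map_sub, (jetAt x).map_smul (a x), (jetAt x).map_smul (b x),
    (jetAt x).map_smul (a x * b x)] at h
  rw [← sub_eq_zero, ← h]
  abel

variable [FiniteDimensional ℝ E] [T2Space M] [IsManifold 𝓘(ℝ, E) ∞ M]

/-- A section of the jet bundle is a combination of prolongations only near `x`. Multiplication by a
bump function makes the local presentation global. -/
theorem exists_bump_smul_eq_zero {Q : Type*} [AddCommGroup Q] [Module (SmoothFun E M) Q]
    (T : JetSec E L → Q) (hadd : ∀ σ τ, T (σ + τ) = T σ + T τ)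
    (hsmul : ∀ (f : SmoothFun E M) σ, T (f • σ) = f • T σ)
    (hj : ∀ p, T (jetProlongation p) = 0) (σ : JetSec E L) (x : M) :
    ∃ χ : SmoothFun E M, χ x = 1 ∧ χ • T σ = 0 := by
  let T' : JetSec E L →+ Q := AddMonoidHom.mk' T hadd
  obtain ⟨c, hc⟩ := σ.exists_eventually_eq x
  obtain ⟨χ, h₁, h₂⟩ := SmoothFun.exists_bump_of_eventually (E := E) hc
  refine ⟨χ, h₁.self_of_nhds, ?_⟩
  have hT (c : LineSec E L →₀ SmoothFun E M) : T (jetCombination c) = 0 := by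
    change T' (jetCombination c) = 0
    induction c using Finsupp.induction_linear with
    | zero => rw [map_zero, map_zero]
    | add c d hc hd => rw [map_add, map_add, hc, hd, add_zero]
    | single s g => rw [jetCombination_single]; exact (hsmul _ _).trans (by rw [hj, smul_zero])
  rw [← hsmul]
  have : χ • σ = χ • jetCombination c := Subtype.ext <| funext fun y => by
    rw [JetSec.smul_apply, JetSec.smul_apply]
    rcases h₂ y with h | h
    · rw [h, zero_smul, zero_smul]
    · rw [h]
  rw [this, hsmul, hT, smul_zero]

theorem determinedOn_fun : DeterminedOn (SmoothFun E M) (SmoothFun E M)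
    (jetProlongation : LineSec E L →ₗ[ℝ] JetSec E L) := by
  intro T hadd hsmul hj σ
  ext x
  obtain ⟨χ, h₁, h₂⟩ := exists_bump_smul_eq_zero T hadd hsmul hj σ x
  have := congrArg (SmoothFun.eval x) h₂
  change χ x * T σ x = 0 at this
  rwa [h₁, one_mul] at this

theorem determinedOn_sec : DeterminedOn (SmoothFun E M) (LineSec E L)
    (jetProlongation : LineSec E L →ₗ[ℝ] JetSec E L) := by
  intro T hadd hsmul hj σ
  ext x
  obtain ⟨χ, h₁, h₂⟩ := exists_bump_smul_eq_zero T hadd hsmul hj σ x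
  have := congrArg (LineSec.eval x) h₂
  change χ x • T σ x = 0 at this
  rwa [h₁, one_smul] at this

theorem determinedOn_jet : DeterminedOn (SmoothFun E M) (JetSec E L)
    (jetProlongation : LineSec E L →ₗ[ℝ] JetSec E L) := by
  intro T hadd hsmul hj σ
  refine Subtype.ext <| funext fun x => ?_
  obtain ⟨χ, h₁, h₂⟩ := exists_bump_smul_eq_zero T hadd hsmul hj σ x
  have := congrArg (JetSec.eval x) h₂
  change χ x • (T σ).1 x = 0 at this
  rwa [h₁, one_smul] at this

theorem IsDerivationOver.eventually_eq_zero {X : Derivation ℝ (SmoothFun E M) (SmoothFun E M)}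
    {Δ : LineSec E L →ₗ[ℝ] LineSec E L} (hΔ : IsDerivationOver X Δ) {q : LineSec E L} {x : M}
    (hq : ∀ᶠ y in 𝓝 x, q y = 0) : Δ q x = 0 := by
  obtain ⟨χ, h₁, h₂⟩ := SmoothFun.exists_bump_of_eventually (E := E) hq
  have h : χ • q = 0 := ContMDiffSection.ext fun y => by
    rw [LineSec.smul_apply]
    rcases h₂ y with h | h
    · rw [h, zero_smul]; rfl
    · rw [h, smul_zero]; rfl
  have h' := congrArg (LineSec.eval x) (hΔ χ q)
  rw [h, map_zero] at h'
  change 0 = X χ x • q x + χ x • Δ q x at h'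
  rwa [hq.self_of_nhds, smul_zero, zero_add, h₁.self_of_nhds, one_smul, eq_comm] at h'

variable [ContMDiffVectorBundle ∞ ℝ L 𝓘(ℝ, E)]

/-- A local frame `e` of `L` at `x`, and the coordinate function of sections, multiplied by
a bump function `χ`. -/
theorem exists_coordinate (x : M) :
    ∃ (φ : LineSec E L →ₗ[SmoothFun E M] SmoothFun E M) (e : LineSec E L) (χ : SmoothFun E M),
      χ x = 1 ∧ e x ≠ 0 ∧ ∀ s, φ s • e = χ • s := by
  let t := trivializationAt ℝ L x
  have hx : x ∈ t.baseSet := FiberBundle.mem_baseSet_trivializationAt' x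
  obtain ⟨χ, h₁, h₂⟩ := SmoothFun.exists_bump (E := E) (t.open_baseSet.mem_nhds hx)
  have hχx : χ x = 1 := h₁.self_of_nhds
  have hφ (s : LineSec E L) :
      ∃ u : SmoothFun E M, ∀ y, u y = χ y * t.linearMapAt ℝ y (s y) := by
    refine SmoothFun.exists_eq_mul_of_tsupport t.open_baseSet h₂ ?_
    refine (t.contMDiffOn_section_baseSet_iff.1 s.contMDiff.contMDiffOn).congr fun y hy => ?_
    rw [t.coe_linearMapAt_of_mem hy]
  choose φ hφ using hφ
  have he : ContMDiffOn 𝓘(ℝ, E) (𝓘(ℝ, E).prod 𝓘(ℝ, ℝ)) ∞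
      (fun y => Bundle.TotalSpace.mk' ℝ y (t.symmₗ ℝ y 1)) t.baseSet := by
    rw [t.contMDiffOn_section_baseSet_iff]
    refine (contMDiffOn_const (c := (1 : ℝ))).congr fun y hy => ?_
    have := t.linearMapAt_symmₗ (R := ℝ) hy 1
    rwa [t.coe_linearMapAt_of_mem hy] at this
  let e : LineSec E L := ⟨fun y => χ y • t.symmₗ ℝ y 1,
    χ.contMDiff.contMDiffOn.smul_section_of_tsupport t.open_baseSet h₂ he⟩
  have hey (y : M) : e y = χ y • t.symmₗ ℝ y 1 := rfl
  -- One factor `χ` extends the coordinate function by zero, the other the local frame, so their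
  -- product reproduces `s` up to `χ * χ`.
  refine ⟨{ toFun := φ
            map_add' := fun s s' => ContMDiffMap.ext fun y => ?_
            map_smul' := fun f s => ContMDiffMap.ext fun y => ?_ }, e, χ * χ, ?_, fun h => ?_,
            fun s => ContMDiffSection.ext fun y => ?_⟩
  · change φ (s + s') y = φ s y + φ s' y
    rw [hφ, hφ, hφ, ← mul_add, ← map_add]
    rfl
  · change φ (f • s) y = f y * φ s y
    rw [hφ, hφ, LineSec.smul_apply, map_smul, smul_eq_mul]
    ring
  · change χ x * χ x = 1
    rw [hχx, one_mul]
  · rw [hey, hχx, one_smul] at h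
    have := t.linearMapAt_symmₗ (R := ℝ) hx 1
    rw [h, map_zero] at this
    exact zero_ne_one this
  · change φ s y • (χ y • t.symmₗ ℝ y 1) = (χ y * χ y) • s y
    by_cases hy : χ y = 0
    · rw [hy, zero_smul, smul_zero, zero_mul, zero_smul]
    have hs := t.symmₗ_linearMapAt (R := ℝ) (h₂ (subset_tsupport _ hy)) (s y)
    conv_rhs => rw [← hs]
    rw [hφ, smul_smul, ← map_smul, ← map_smul]
    congr 1
    simp only [smul_eq_mul]
    ring

theorem SmoothFun.eq_zero_of_smul_eq_zero (L : M → Type*)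
    [TopologicalSpace (Bundle.TotalSpace ℝ L)]
    [∀ x, AddCommGroup (L x)] [∀ x, Module ℝ (L x)] [∀ x, TopologicalSpace (L x)]
    [FiberBundle ℝ L] [VectorBundle ℝ ℝ L] [ContMDiffVectorBundle ∞ ℝ L 𝓘(ℝ, E)]
    (a : SmoothFun E M) (ha : ∀ p : LineSec E L, a • p = 0) : a = 0 := by
  ext x
  obtain ⟨-, e, -, -, he, -⟩ := exists_coordinate (E := E) (L := L) x
  have := congrArg (LineSec.eval x) (ha e)
  exact (smul_eq_zero.1 this).resolve_right he

/-- The first order operators `Γ(L) → Γ(L)` separate the jets at `x`. -/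
theorem jetAt_eq_zero {x : M} {s : LineSec E L}
    (hs : ∀ D : LineSec E L →ₗ[ℝ] LineSec E L, IsFirstOrderDiffOp (SmoothFun E M) D →
      D s x = 0) : jetAt x s = 0 := by
  obtain ⟨φ, e, χ, hχ, he, hφ⟩ := exists_coordinate (E := E) (L := L) x
  have hsx : s x = 0 := hs LinearMap.id
    (isFirstOrderDiffOp_iff.2 fun a b p => by simp only [LinearMap.id_apply]; module)
  have h₀ : φ s x = 0 := by
    have := congrArg (LineSec.eval x) (hφ s)
    change φ s x • e x = χ x • s x at this
    rw [hsx, smul_zero] at this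
    exact (smul_eq_zero.1 this).resolve_right he
  have h₁ (V : Derivation ℝ (SmoothFun E M) (SmoothFun E M)) : V (φ s) x = 0 := by
    -- Differentiating the coordinate of `s` along `V` is a first order operator `Γ(L) → Γ(L)`, so
    -- the hypothesis controls all first derivatives.
    let D : LineSec E L →ₗ[ℝ] LineSec E L :=
      { toFun := fun s => V (φ s) • e
        map_add' := fun s s' => by rw [map_add, map_add, add_smul]
        map_smul' := fun r s => by
          rw [← algebraMap_smul (SmoothFun E M) r s, map_smul, algebraMap_smul,
            Derivation.map_smul, RingHom.id_apply, smul_assoc] }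
    have hD : IsFirstOrderDiffOp (SmoothFun E M) D := isFirstOrderDiffOp_iff.2 fun a b p => by
      change V (φ (a • b • p)) • e =
        a • V (φ (b • p)) • e + b • V (φ (a • p)) • e - (a * b) • V (φ p) • e
      simp only [map_smul, smul_eq_mul, Derivation.leibniz]
      module
    exact (smul_eq_zero.1 (hs D hD)).resolve_right he
  have hd : fderiv ℝ (φ s ∘ (extChartAt 𝓘(ℝ, E) x).symm) (extChartAt 𝓘(ℝ, E) x x) = 0 := by
    ext v
    obtain ⟨ψ, hψ, hψ'⟩ := SmoothFun.exists_bump (E := E)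
      (extChartAt_source_mem_nhds (I := 𝓘(ℝ, E)) x)
    obtain ⟨V, hV⟩ := SmoothFun.exists_derivation hψ' v
    have := h₁ V
    rwa [hV, hψ.self_of_nhds, one_mul] at this
  have hmem : φ s ∈ vanishingIdeal E x ^ 2 := SmoothFun.mem_sq_vanishingIdeal h₀ hd
  have hχ' : (1 - χ) ^ 2 ∈ vanishingIdeal E x ^ 2 := by
    refine Ideal.pow_mem_pow ?_ 2
    change 1 - χ x = 0
    rw [hχ, sub_self]
  -- This uses `(1 - χ)² + (2 - χ) χ = 1`; both summands lie in `μ_x² Γ(L)`.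
  have hdec : s = (1 - χ) ^ 2 • s + (2 - χ) • φ s • e := by
    rw [hφ]; module
  rw [hdec]
  exact jetAt_eq_zero_of_mem <| Submodule.add_mem _ (Submodule.smul_mem_smul hχ' trivial)
    (Submodule.smul_mem _ _ (Submodule.smul_mem_smul hmem trivial))

end JetBundle

/-! ### The Lie derivative on sections of the jet bundle -/

section LieDerivative

variable {E : Type*} [NormedAddCommGroup E] [NormedSpace ℝ E] {M : Type*} [TopologicalSpace M]
  [ChartedSpace E M] {L : M → Type*} [TopologicalSpace (Bundle.TotalSpace ℝ L)]
  [∀ x, AddCommGroup (L x)] [∀ x, Module ℝ (L x)] [∀ x, TopologicalSpace (L x)]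
  [FiberBundle ℝ L] [VectorBundle ℝ ℝ L]

/-- The value `∑ (f_i • j₁ (Δ s_i) + X f_i • j₁ s_i)` on `∑ f_i • j₁ s_i` of the Lie derivative
along a derivation `Δ` with symbol `X`. -/
def jetLieCombination (X : Derivation ℝ (SmoothFun E M) (SmoothFun E M))
    (Δ : LineSec E L →ₗ[ℝ] LineSec E L) : (LineSec E L →₀ SmoothFun E M) →+ JetSec E L :=
  Finsupp.liftAddHom fun s =>
    (smulAddHom (SmoothFun E M) (JetSec E L)).flip (jetProlongation (Δ s)) +
      ((smulAddHom (SmoothFun E M) (JetSec E L)).flip (jetProlongation s)).comp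
        (X : SmoothFun E M →ₗ[ℝ] SmoothFun E M).toAddMonoidHom

variable {X : Derivation ℝ (SmoothFun E M) (SmoothFun E M)} {Δ : LineSec E L →ₗ[ℝ] LineSec E L}

theorem jetLieCombination_single (s : LineSec E L) (f : SmoothFun E M) :
    jetLieCombination X Δ (Finsupp.single s f) =
      f • jetProlongation (Δ s) + X f • jetProlongation s := by
  simp [jetLieCombination]

theorem jetLieCombination_smul (f : SmoothFun E M) (c : LineSec E L →₀ SmoothFun E M) :
    jetLieCombination X Δ (f • c) =
      X f • jetCombination c + f • jetLieCombination X Δ c := by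
  induction c using Finsupp.induction_linear with
  | zero => simp
  | add c d hc hd => rw [smul_add, map_add, hc, hd, map_add, map_add]; module
  | single s g =>
    rw [Finsupp.smul_single, jetCombination_single, jetLieCombination_single,
      jetLieCombination_single, smul_eq_mul, X.leibniz, smul_eq_mul, smul_eq_mul]
    module

/-- `Δ` has scalar symbol, so the second order parts of `Δ ∘ D` and `D ∘ Δ` cancel. -/
theorem isFirstOrderDiffOp_commutator (hΔ : IsDerivationOver X Δ)
    {D : LineSec E L →ₗ[ℝ] LineSec E L} (hD : IsFirstOrderDiffOp (SmoothFun E M) D) :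
    IsFirstOrderDiffOp (SmoothFun E M) (Δ ∘ₗ D - D ∘ₗ Δ) := by
  rw [isFirstOrderDiffOp_iff] at hD ⊢
  intro a b p
  simp only [LinearMap.sub_apply, LinearMap.comp_apply, hΔ _ _, map_add, hD, map_sub,
    smul_add, Derivation.leibniz, smul_eq_mul]
  module

variable [FiniteDimensional ℝ E] [T2Space M] [IsManifold 𝓘(ℝ, E) ∞ M]
  [ContMDiffVectorBundle ∞ ℝ L 𝓘(ℝ, E)]

/-- This makes the Lie derivative independent of the presentation. Every first order `D` is tested
on the value at `x`, using `T_D (ℒ c) = Δ (T_D (j c)) - T_{[Δ, D]} (j c)`. Vanishing is needed near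
`x`, and not only at `x`, because `Δ` differentiates. -/
theorem jetLieCombination_eval_eq_zero (hΔ : IsDerivationOver X Δ)
    {c : LineSec E L →₀ SmoothFun E M} {x : M}
    (hc : ∀ᶠ y in 𝓝 x, (jetCombination c).1 y = 0) : (jetLieCombination X Δ c).1 x = 0 := by
  obtain ⟨s, hs⟩ := Submodule.mkQ_surjective (vanishingToFirstOrder E L x)
    ((jetLieCombination X Δ c).1 x)
  replace hs : jetAt x s = (jetLieCombination X Δ c).1 x := hs
  rw [← hs]
  refine jetAt_eq_zero fun D hD => ?_
  obtain ⟨T, hT⟩ := exists_lift_sec hD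
  obtain ⟨C, hC⟩ := exists_lift_sec (isFirstOrderDiffOp_commutator hΔ hD)
  have hTj (p) : T (jetProlongation p) = D p := ContMDiffSection.ext fun x => hT _ x p rfl
  have hCj (p) : C (jetProlongation p) = Δ (D p) - D (Δ p) :=
    ContMDiffSection.ext fun x => hC _ x p rfl
  have key (c : LineSec E L →₀ SmoothFun E M) :
      T (jetLieCombination X Δ c) = Δ (T (jetCombination c)) - C (jetCombination c) := by
    induction c using Finsupp.induction_linear with
    | zero => simp
    | add c d hc hd => simp only [map_add, hc, hd]; abel
    | single s g =>
      rw [jetCombination_single, jetLieCombination_single, map_add, T.map_smul, T.map_smul,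
        T.map_smul, C.map_smul, hTj, hTj, hCj, hΔ]
      module
  have h₁ : ∀ᶠ y in 𝓝 x, T (jetCombination c) y = 0 := by
    filter_upwards [hc] with y hy
    rw [hT _ y 0 (by rw [hy, map_zero]), map_zero]
    rfl
  have h₂ : C (jetCombination c) x = 0 := by
    rw [hC _ x 0 (by rw [hc.self_of_nhds, map_zero]), map_zero]
    rfl
  rw [← hT _ x s hs.symm, key]
  change Δ (T (jetCombination c)) x - C (jetCombination c) x = 0
  rw [hΔ.eventually_eq_zero h₁, h₂, sub_zero]

theorem exists_jet_lieDerivative (hΔ : IsDerivationOver X Δ) :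
    ∃ T : JetSec E L →ₗ[ℝ] JetSec E L,
      (∀ p, T (jetProlongation p) = jetProlongation (Δ p)) ∧ IsDerivationOver X T := by
  choose c hc using fun (σ : JetSec E L) (x : M) => σ.exists_eventually_eq x
  let T (σ : JetSec E L) (x : M) : JetFiber E L x := (jetLieCombination X Δ (c σ x)).1 x
  have hT (σ : JetSec E L) (x : M) (d : LineSec E L →₀ SmoothFun E M)
      (hd : ∀ᶠ y in 𝓝 x, σ.1 y = (jetCombination d).1 y) :
      T σ x = (jetLieCombination X Δ d).1 x := by
    rw [← sub_eq_zero]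
    have h := jetLieCombination_eval_eq_zero hΔ (c := c σ x - d) (x := x) (by
      filter_upwards [hc σ x, hd] with y h₁ h₂
      rw [map_sub]
      exact sub_eq_zero.2 (h₁.symm.trans h₂))
    rw [map_sub] at h
    exact h
  have hsmooth (σ : JetSec E L) : IsSmoothJetFamily (T σ) := by
    intro x
    obtain ⟨d, hd⟩ := (jetLieCombination X Δ (c σ x)).2 x
    refine ⟨d, ?_⟩
    filter_upwards [hd, (hc σ x).eventually_nhds] with y hy hcy
    -- The presentation chosen at `x` is also valid near each nearby `y`, so it computes `T σ`
    -- there.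
    rw [hT σ y _ hcy, hy]
  have hadd (σ τ : JetSec E L) : T (σ + τ) = T σ + T τ := by
    funext x
    rw [hT (σ + τ) x (c σ x + c τ x), map_add]
    · rfl
    filter_upwards [hc σ x, hc τ x] with y h₁ h₂
    rw [map_add]
    exact congrArg₂ (· + ·) h₁ h₂
  have hsmul (f : SmoothFun E M) (σ : JetSec E L) (x : M) :
      T (f • σ) x = X f x • σ.1 x + f x • T σ x := by
    rw [hT (f • σ) x (f • c σ x), jetLieCombination_smul, (hc σ x).self_of_nhds]
    · rfl
    filter_upwards [hc σ x] with y h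
    rw [jetCombination_smul, JetSec.smul_apply, JetSec.smul_apply, h]
  refine ⟨{ toFun := fun σ => ⟨T σ, hsmooth σ⟩
            map_add' := fun σ τ => Subtype.ext (hadd σ τ)
            map_smul' := fun r σ => Subtype.ext <| funext fun x => ?_ },
    fun p => Subtype.ext <| funext fun x => ?_, fun f σ => Subtype.ext <| funext (hsmul f σ)⟩
  -- Real homogeneity is the Leibniz rule for a constant function, which `X` annihilates.
  · have := hsmul (algebraMap ℝ _ r) σ x
    have h₀ : (0 : SmoothFun E M) x = 0 := rfl
    have hr : (algebraMap ℝ (SmoothFun E M) r) x = r := rfl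
    rw [algebraMap_smul, Derivation.map_algebraMap, h₀, hr, zero_smul, zero_add] at this
    exact this
  · have h := hT (jetProlongation p) x (Finsupp.single p 1) (by
      simp only [jetCombination_single, one_smul, Filter.eventually_true])
    rw [jetLieCombination_single, one_smul, Derivation.map_one_eq_zero, zero_smul, add_zero] at h
    exact h

theorem isJetProlongation_jetProlongation : IsJetProlongation (SmoothFun E M)
    (jetProlongation : LineSec E L →ₗ[ℝ] JetSec E L) where
  injective := jetProlongation_injective
  firstOrder := isFirstOrderDiffOp_jetProlongation
  faithful := SmoothFun.eq_zero_of_smul_eq_zero L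
  determined_fun := determinedOn_fun
  determined_sec := determinedOn_sec
  determined_jet := determinedOn_jet
  lift_fun D hD := by
    obtain ⟨T, hT⟩ := exists_lift_fun hD
    exact ⟨T, fun p => ContMDiffMap.ext fun x => hT _ x p rfl⟩
  lift_sec D hD := by
    obtain ⟨T, hT⟩ := exists_lift_sec hD
    exact ⟨T, fun p => ContMDiffSection.ext fun x => hT _ x p rfl⟩
  lieDerivative _ _ hΔ := exists_jet_lieDerivative hΔ

end LieDerivative

end

theorem mainTheorem11 {E : Type*} [NormedAddCommGroup E] [NormedSpace ℝ E]
    [FiniteDimensional ℝ E] {M : Type*} [TopologicalSpace M] [T2Space M]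
    [SecondCountableTopology M] [ChartedSpace E M] [IsManifold 𝓘(ℝ, E) ∞ M]
    (L : M → Type*) [TopologicalSpace (Bundle.TotalSpace ℝ L)] [∀ x, AddCommGroup (L x)]
    [∀ x, Module ℝ (L x)] [∀ x, TopologicalSpace (L x)] [FiberBundle ℝ L]
    [VectorBundle ℝ ℝ L] [ContMDiffVectorBundle ∞ ℝ L 𝓘(ℝ, E)] :
    ∃ e : DegNegOneJacobiBracket (SmoothFun E M) (LineSec E L) ≃
        {𝒥 : JacobiAlgebroidStructure (SmoothFun E M) (JetSec E L) (LineSec E L) //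
          ∀ p₁ p₂ : LineSec E L,
            𝒥.bracket (jetProlongation p₁) (jetProlongation p₂) =
              jetProlongation (𝒥.nabla (jetProlongation p₁) p₂)},
      ∀ B : DegNegOneJacobiBracket (SmoothFun E M) (LineSec E L),
        (∀ p₁ p₂ : LineSec E L,
          B.bracket (TrivSqZeroExt.inr p₁) (TrivSqZeroExt.inr p₂) =
            TrivSqZeroExt.inr ((e B).1.nabla (jetProlongation p₁) p₂)) ∧
        (∀ (p : LineSec E L) (a : SmoothFun E M),
          B.bracket (TrivSqZeroExt.inr p) (TrivSqZeroExt.inl a) =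
            TrivSqZeroExt.inl ((e B).1.anchor (jetProlongation p) a)) ∧
        ∀ 𝒥 : {𝒥 : JacobiAlgebroidStructure (SmoothFun E M) (JetSec E L) (LineSec E L) //
            ∀ p₁ p₂ : LineSec E L,
              𝒥.bracket (jetProlongation p₁) (jetProlongation p₂) =
                jetProlongation (𝒥.nabla (jetProlongation p₁) p₂)},
          (∀ p₁ p₂ : LineSec E L,
            B.bracket (TrivSqZeroExt.inr p₁) (TrivSqZeroExt.inr p₂) =
              TrivSqZeroExt.inr (𝒥.1.nabla (jetProlongation p₁) p₂)) →
          𝒥 = e B :=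
  isJetProlongation_jetProlongation.exists_equiv
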